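/- Let $\mathcal{M}$ be a tabular Markov reward process on a finite state space $\mathcal{S}\cup\{\emptyset\}$ with terminal state $\emptyset\notin\mathcal{S}$, transition kernel $P$ with $P(\emptyset\mid\emptyset)=1$, reward distributions $R(\cdot\mid s)$ with $R(\emptyset)=0$, and initial distribution $\mu$. A trajectory is a random sequence $(S_0,R_0,S_1,R_1,\dots)$ with $S_0\sim\mu$ such that, given $(S_0,R_0,\dots,R_{t-1},S_t)$ with $S_t=s$, the law of the pair $(R_t,S_{t+1})$ depends only on $s$ and has marginals $R(\cdot\mid s)$ and $P(\cdot\mid s)$ (for instance, but not necessarily, $R_t$ and $S_{t+1}$ are conditionally independent given $S_t$). Write $\mathbb{P}_\mu$ for its law, and $\mathbb{P}_s,\mathbb{E}_s$ for the law and expectation when $S_0=s$. Assume that the rewards satisfy $|R_t|\le 1$ almost surely from every state, and that for some $h$, with $T_\emptyset=\inf\{t>0:S_t=\emptyset\}$, $$\mathbb{E}_s\big[T_\emptyset^p\big]\le (ph)^p\qquad\text{for all } s\in\mathcal{S} \text{ and all integers } p\ge 1 .$$ Let $$V^\star(s)=\mathbb{E}_s\Big[\sum_{t=0}^\infty R_t\Big],\qquad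 \sigma^2_{V^\star}(s)=\mathrm{Var}\big[R_0+V^\star(S_1)\mid S_0=s\big],\qquad \nu(s)=\sum_{t=0}^\infty\mathbb{P}_\mu(S_t=s),$$ and let $\mathcal{S}_+=\{s\in\mathcal{S}:\nu(s)>0\}$ be the set of reachable states (so $\mathcal{S}_+=\mathcal{S}$ if every state is reachable). Given i.i.d. trajectories $(S^{(i)}_t,R^{(i)}_t)_{t\ge0}$, $i\ge1$, let $$\widehat V_{\mathrm{MC}}(s)=\frac{\sum_{i=1}^n\sum_{t=0}^\infty \mathbf 1\{S^{(i)}_t=s\}\sum_{\ell=t}^\infty R^{(i)}_\ell}{\sum_{i=1}^n\sum_{t=0}^\infty \mathbf 1\{S^{(i)}_t=s\}}\qquad (0/0=0)$$ be the every-visit Monte Carlo estimator based on the first $n$ trajectories. Then all the quantities above and below are well defined and finite: for every initial state the series $\sum_t R_t$ converges almost surely to an integrable random variable and $\sigma^2_{V^\star}<\infty$, and $\nu(s)<\infty$ and the sum defining $\Sigma^\star_{\mathrm{MC}}(s,s')$ is finite. Moreover, as $n\to\infty$, jointly over $s\in\mathcal{S}_+$, $$\sqrt n\,\big(V^\star-\widehat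 V_{\mathrm{MC}}\big)\xrightarrow{d}\mathcal N\big(0,\Sigma^\star_{\mathrm{MC}}\big)\quad\text{in } \mathbb{R}^{\mathcal{S}_+},$$ where $\Sigma^\star_{\mathrm{MC}}$ is the positive semidefinite matrix with entries $$\Sigma^\star_{\mathrm{MC}}(s,s')=\frac{1}{\nu(s)\nu(s')}\sum_{t=0}^\infty\sum_{t'=0}^\infty\sum_{j=t\vee t'}^\infty\sum_{s''\in\mathcal{S}}\mathbb{P}_\mu(S_t=s,\,S_{t'}=s',\,S_j=s'')\,\sigma^2_{V^\star}(s'').$$ -/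

import Mathlib

open MeasureTheory ProbabilityTheory Filter Topology
open scoped ENNReal

/-- A (tabular) Markov reward process on the finite augmented state space `X = 𝒮 ∪ {∅}`.

`step s` is the joint law of the reward `R_t` and of the next state `S_{t+1}` given `S_t = s`;
its marginals are the reward distribution `R(· | s)` and the transition law `P(· | s)`. The case of
a reward that is conditionally independent of the next state is `step = reward ×ₖ trans`; no such
independence is required. -/
structure MRP (X : Type*) [MeasurableSpace X] where
  /-- the terminal state `∅` -/
  term : X
  /-- the transition kernel `P` -/
  trans : Kernel X X
  /-- the reward distribution `R` -/
  reward : Kernel X ℝ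
  /-- the initial distribution `μ` -/
  init : Measure X
  /-- the joint conditional law of `(R_t, S_{t+1})` given `S_t` -/
  step : Kernel X (ℝ × X)
  isMarkov_step : IsMarkovKernel step
  isProb_init : IsProbabilityMeasure init
  step_fst : step.fst = reward
  step_snd : step.snd = trans
  trans_term : trans term = Measure.dirac term
  reward_term : reward term = Measure.dirac 0

namespace MRP

variable {X : Type*} [MeasurableSpace X]

instance (M : MRP X) : IsMarkovKernel M.step := M.isMarkov_step

instance (M : MRP X) : IsProbabilityMeasure M.init := M.isProb_init

/-- The space of trajectories. A trajectory `(S_0, R_0, S_1, R_1, …)`, continued forever after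
absorption in `∅`, is stored as the sequence `(0, S_0), (R_0, S_1), (R_1, S_2), …`. -/
abbrev Traj (X : Type*) : Type _ := ℕ → ℝ × X

/-- The state `S_t` of a trajectory. -/
def S (t : ℕ) (x : Traj X) : X := (x t).2

/-- The reward `R_t` of a trajectory. -/
def R (t : ℕ) (x : Traj X) : ℝ := (x (t + 1)).1

/-- The sub-trajectory `(S_t, R_t, S_{t+1}, R_{t+1}, …)`. -/
def shift (t : ℕ) (x : Traj X) : Traj X := fun k => x (t + k)

/-- The total reward `∑_{t ≥ 0} R_t` of a trajectory. -/
noncomputable def total (x : Traj X) : ℝ := ∑' t : ℕ, R t x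

/-- The number of visits `N(s) = ∑_{t ≥ 0} 1{S_t = s}` of a trajectory. -/
noncomputable def visits (s : X) (x : Traj X) : ℝ :=
  ∑' t : ℕ, Set.indicator {y : Traj X | S t y = s} (fun _ => (1 : ℝ)) x

/-- The sum of the total rewards of those sub-trajectories that start at `s`. -/
noncomputable def rolloutSum (s : X) (x : Traj X) : ℝ :=
  ∑' t : ℕ, Set.indicator {y : Traj X | S t y = s} (fun y => total (shift t y)) x

/-- The every-visit Monte Carlo estimate of the value at `s` from the trajectories
`τ 0, …, τ (n - 1)`: the average of the total reward over all sub-trajectories that start at `s`,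
with the convention `0 / 0 = 0`. -/
noncomputable def mcEstimate (n : ℕ) (τ : ℕ → Traj X) (s : X) : ℝ :=
  (∑ i ∈ Finset.range n, rolloutSum s (τ i)) / (∑ i ∈ Finset.range n, visits s (τ i))

variable (M : MRP X)

/-- The law of a trajectory with `S_0 ∼ ρ`: given `(S_0, R_0, …, R_{t-1}, S_t)`, the pair
`(R_t, S_{t+1})` has law `step S_t`. -/
noncomputable def law (ρ : Measure X) [IsProbabilityMeasure ρ] : Measure (Traj X) :=
  haveI : IsProbabilityMeasure (ρ.map (fun s => ((0 : ℝ), s))) :=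
    Measure.isProbabilityMeasure_map (by fun_prop)
  Kernel.trajMeasure (X := fun _ : ℕ => ℝ × X) (ρ.map (fun s => ((0 : ℝ), s)))
    (fun n => M.step.comap
      (fun y : (i : Finset.Iic n) → ℝ × X => (y ⟨n, Finset.mem_Iic.2 le_rfl⟩).2) (by fun_prop))

/-- The law `ℙ_s` of a trajectory started at `S_0 = s`. -/
noncomputable def lawAt (s : X) : Measure (Traj X) := M.law (Measure.dirac s)

/-- The law `ℙ_μ` of a trajectory started from the initial distribution. -/
noncomputable def lawInit : Measure (Traj X) := M.law M.init

/-- The hitting time `T_∅ = inf {t > 0 : S_t = ∅}`, with `inf ∅ = ∞`. -/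
noncomputable def hitTime (x : Traj X) : ℝ≥0∞ :=
  ⨅ (t : ℕ) (_ : 0 < t ∧ S t x = M.term), (t : ℝ≥0∞)

/-- The effective horizon assumption: `𝔼_s[T_∅ ^ p] ≤ (p h) ^ p` for all `s ≠ ∅`, `p ≥ 1`. -/
def EffHorizon (h : ℝ) : Prop :=
  ∀ s : X, s ≠ M.term → ∀ p : ℕ, 1 ≤ p →
    ∫⁻ x, M.hitTime x ^ p ∂(M.lawAt s) ≤ ENNReal.ofReal ((p * h) ^ p)

/-- The rewards are bounded by one. -/
def BoundedReward : Prop := ∀ s : X, ∀ᵐ r ∂(M.reward s), |r| ≤ 1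

/-- The value function `V⋆(s) = 𝔼_s[∑_{t ≥ 0} R_t]`. -/
noncomputable def value (s : X) : ℝ := ∫ x, total x ∂(M.lawAt s)

/-- The one-step variance `σ²(s) = Var[R_0 + V⋆(S_1) | S_0 = s]`, in `[0, ∞]`. -/
noncomputable def oneStepVar (s : X) : ℝ≥0∞ :=
  evariance (fun x : Traj X => R 0 x + M.value (S 1 x)) (M.lawAt s)

/-- The occupancy measure `ν(s) = ∑_{t ≥ 0} ℙ_μ(S_t = s)`, in `[0, ∞]`. -/
noncomputable def occ (s : X) : ℝ≥0∞ := ∑' t : ℕ, M.lawInit {x | S t x = s}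

/-- The set `𝒮` of non-terminal states. -/
abbrev State : Type _ := {s : X // s ≠ M.term}

/-- The non-terminal states that are reachable, that is, have positive occupancy. -/
abbrev Reachable : Type _ := {s : X // s ≠ M.term ∧ 0 < M.occ s}

/-- The sum `∑_{t ≥ 0} ∑_{t' ≥ 0} ∑_{j ≥ t ∨ t'} ∑_{s'' ∈ 𝒮} ℙ_μ(S_t = s, S_{t'} = s', S_j = s'')
σ²(s'')`, in `[0, ∞]`. -/
noncomputable def visitVarSum (s s' : X) : ℝ≥0∞ :=
  ∑' t : ℕ, ∑' t' : ℕ, ∑' j : {j : ℕ // max t t' ≤ j}, ∑' s'' : M.State,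
    M.lawInit {x | S t x = s ∧ S t' x = s' ∧ S j x = s''} * M.oneStepVar s''

/-- The asymptotic covariance matrix `Σ⋆_MC`, on the reachable states. -/
noncomputable def mcCov : Matrix M.Reachable M.Reachable ℝ :=
  Matrix.of fun s s' =>
    1 / ((M.occ s).toReal * (M.occ s').toReal) * (M.visitVarSum s s').toReal

noncomputable instance [Finite X] : Fintype M.Reachable := Fintype.ofFinite _

noncomputable instance : DecidableEq M.Reachable := Classical.decEq _

end MRP

/-! Fix a nonterminal `s`. The centred rollout sum `residual s` weights the deviation of the return
after time `t` from `V⋆(s)` by the indicator of `S_t = s`. After absorption rewards and values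
vanish, so this deviation telescopes into the temporal difference errors `δ_j`, `j ≥ t`. Exchanging
the two sums gives `∑_j δ_j N_j(s)`, with `N_j(s)` the number of visits up to time `j`
(`residual_eq_residualMart`).

The Bellman equation makes `δ_j` conditionally centred given the history up to `S_j`, and `N_j(s)`
is a function of that history. The partial sums thus form a martingale with orthogonal increments,
so the residual has mean zero, and the second moment for `s, s'` is `∑_j 𝔼[N_j(s) N_j(s') σ²(S_j)]`
(`integral_residualMart_mul`). Expanding the two visit counts turns this into the sum in `Σ⋆_MC`
(`visitVarSum_eq`). The passage to the limit is dominated convergence: the martingale is bounded by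
a constant times `T_∅ ^ 2`, uniformly in the number of terms (`exists_abs_residualMart_le`), and the
horizon assumption makes the fourth moment of `T_∅` finite.

The error `√n (V⋆ - V̂)` at `s` equals the normalised sum of the i.i.d. terms `-ν(s)⁻¹ residual s`
times the ratio of `ν(s)` to the empirical mean number of visits (`sqrt_mul_value_sub_mcEstimate`).
The vector of first factors obeys a multivariate central limit theorem, the second factors tend to
one by the strong law, and Slutsky's theorem concludes. -/

namespace MRP

/-! ### The trajectory measure and its one-step Markov property -/

section Law

variable {X : Type*} [MeasurableSpace X] (M : MRP X)

instance (ρ : Measure X) [IsProbabilityMeasure ρ] : IsProbabilityMeasure (M.law ρ) := by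
  have : IsProbabilityMeasure (ρ.map (fun s => ((0 : ℝ), s))) :=
    Measure.isProbabilityMeasure_map (by fun_prop)
  unfold law
  infer_instance

instance (s : X) : IsProbabilityMeasure (M.lawAt s) := by
  unfold lawAt; infer_instance

instance : IsProbabilityMeasure M.lawInit := by
  unfold lawInit; infer_instance

@[fun_prop]
lemma measurable_S (t : ℕ) : Measurable (S t : Traj X → X) := by
  unfold S; fun_prop

@[fun_prop]
lemma measurable_R (t : ℕ) : Measurable (R t : Traj X → ℝ) := by
  unfold R; fun_prop

/-- The law of a trajectory up to time `n + 1` is obtained from its law up to time `n`. -/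
lemma map_law_succ (ρ : Measure X) [IsProbabilityMeasure ρ] (n : ℕ) :
    ((M.law ρ).map (Preorder.frestrictLe n)) ⊗ₘ
      (M.step.comap (fun y : (i : Finset.Iic n) → ℝ × X =>
        (y ⟨n, Finset.mem_Iic.2 le_rfl⟩).2) (by fun_prop)) =
    (M.law ρ).map (fun x => (Preorder.frestrictLe n x, x (n + 1))) := by
  have : IsProbabilityMeasure (ρ.map (fun s => ((0 : ℝ), s))) :=
    Measure.isProbabilityMeasure_map (by fun_prop)
  exact Kernel.map_frestrictLe_trajMeasure_compProd_eq_map_trajMeasure (X := fun _ : ℕ => ℝ × X)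

/-- The past and the next step are jointly distributed as a composition product, so null sets can be
tested fibrewise. Countability of `X` gives joint measurability from measurability of each section.
-/
lemma ae_law_of_ae_step [DiscreteMeasurableSpace X] [Countable X]
    (ρ : Measure X) [IsProbabilityMeasure ρ] (n : ℕ) (p : X → ℝ × X → Prop)
    (hp : ∀ s, MeasurableSet {y | p s y}) (h : ∀ s, ∀ᵐ y ∂(M.step s), p s y) :
    ∀ᵐ x ∂(M.law ρ), p (S n x) (x (n + 1)) := by
  have hm : MeasurableSet {z : ((i : Finset.Iic n) → ℝ × X) × (ℝ × X) |
      p (z.1 ⟨n, Finset.mem_Iic.2 le_rfl⟩).2 z.2} := by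
    have : MeasurableSet {z : X × (ℝ × X) | p z.1 z.2} := by
      have : {z : X × (ℝ × X) | p z.1 z.2} = ⋃ s : X, {s} ×ˢ {y | p s y} := by
        ext z; simp
      rw [this]
      exact MeasurableSet.iUnion fun s => (MeasurableSet.of_discrete).prod (hp s)
    have hf : Measurable (fun z : ((i : Finset.Iic n) → ℝ × X) × (ℝ × X) =>
      ((z.1 ⟨n, Finset.mem_Iic.2 le_rfl⟩).2, z.2)) := by fun_prop
    exact hf this
  have key : ∀ᵐ z ∂((M.law ρ).map (fun x => (Preorder.frestrictLe n x, x (n + 1)))),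
      p (z.1 ⟨n, Finset.mem_Iic.2 le_rfl⟩).2 z.2 := by
    rw [← map_law_succ]
    rw [Measure.ae_compProd_iff hm]
    exact ae_of_all _ fun y => h _
  rw [ae_map_iff (by fun_prop) hm] at key
  exact key

/-- The one-step Markov property: a functional of the first `n + 1` coordinates can be pulled out
of the conditional expectation of the next step. -/
lemma integral_law_mul_step [DiscreteMeasurableSpace X] [Countable X]
    (ρ : Measure X) [IsProbabilityMeasure ρ] (n : ℕ) (F : Traj X → ℝ)
    (hF : Measurable F) (hdep : DependsOn F (Set.Iic n)) (g : X → ℝ × X → ℝ)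
    (hg : ∀ s, Measurable (g s))
    (hint : Integrable (fun x => F x * g (S n x) (x (n + 1))) (M.law ρ)) :
    ∫ x, F x * g (S n x) (x (n + 1)) ∂(M.law ρ) =
      ∫ x, F x * ∫ y, g (S n x) y ∂(M.step (S n x)) ∂(M.law ρ) := by
  classical
  have hx0 : Nonempty (Traj X) := nonempty_of_isProbabilityMeasure (M.law ρ)
  obtain ⟨x0⟩ := hx0
  -- Padding a finite history with an arbitrary fixed trajectory turns `F` into a function of that
  -- history; by `hdep` the padding does not matter.
  let e : ((i : Finset.Iic n) → ℝ × X) → Traj X :=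
    fun y k => if hk : k ≤ n then y ⟨k, Finset.mem_Iic.2 hk⟩ else x0 k
  have he : Measurable e := by
    refine measurable_pi_lambda _ fun k => ?_
    by_cases hk : k ≤ n
    · simp only [e, hk, dif_pos]; fun_prop
    · simp only [e, hk, dif_neg, not_false_eq_true]; fun_prop
  have hFe : ∀ x, F (e (Preorder.frestrictLe n x)) = F x := fun x => by
    refine hdep fun k hk => ?_
    have hk : k ≤ n := hk
    simp [e, hk]
  have hgm : Measurable (fun z : X × (ℝ × X) => g z.1 z.2) :=
    measurable_from_prod_countable_right hg
  let H : ((i : Finset.Iic n) → ℝ × X) × (ℝ × X) → ℝ := fun z =>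
    F (e z.1) * g (z.1 ⟨n, Finset.mem_Iic.2 le_rfl⟩).2 z.2
  have hH : Measurable H := by
    refine (hF.comp (he.comp measurable_fst)).mul ?_
    exact hgm.comp (f := fun z : ((i : Finset.Iic n) → ℝ × X) × (ℝ × X) =>
      ((z.1 ⟨n, Finset.mem_Iic.2 le_rfl⟩).2, z.2)) (by fun_prop)
  have hHx : ∀ x : Traj X, H (Preorder.frestrictLe n x, x (n + 1)) =
      F x * g (S n x) (x (n + 1)) := fun x => by
    simp only [H, hFe]; rfl
  have hpm : Measurable fun x : Traj X =>
      (Preorder.frestrictLe (π := fun _ => ℝ × X) n x, x (n + 1)) := by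
    fun_prop
  have hHint : Integrable H
      ((M.law ρ).map (fun x => (Preorder.frestrictLe n x, x (n + 1)))) := by
    rw [integrable_map_measure hH.aestronglyMeasurable hpm.aemeasurable]
    exact hint.congr (ae_of_all _ fun x => (hHx x).symm)
  have h1 : ∫ x, F x * g (S n x) (x (n + 1)) ∂(M.law ρ) =
      ∫ z, H z ∂((M.law ρ).map (fun x => (Preorder.frestrictLe n x, x (n + 1)))) := by
    rw [integral_map hpm.aemeasurable hH.aestronglyMeasurable]
    exact integral_congr_ae (ae_of_all _ fun x => (hHx x).symm)
  rw [h1, ← map_law_succ]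
  rw [← map_law_succ] at hHint
  rw [Measure.integral_compProd hHint, integral_map (by fun_prop)]
  · refine integral_congr_ae (ae_of_all _ fun x => ?_)
    simp only [H, hFe, integral_const_mul]
    rfl
  · exact (hH.stronglyMeasurable.integral_kernel_prod_right').aestronglyMeasurable

lemma lintegral_law_eq_traj (ρ : Measure X) [IsProbabilityMeasure ρ] (f : Traj X → ℝ≥0∞)
    (hf : Measurable f) :
    ∫⁻ x, f x ∂(M.law ρ) = ∫⁻ s, ∫⁻ x, f x ∂(Kernel.traj (X := fun _ : ℕ => ℝ × X)
      (fun n => M.step.comap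
        (fun y : (i : Finset.Iic n) → ℝ × X => (y ⟨n, Finset.mem_Iic.2 le_rfl⟩).2) (by fun_prop)) 0
      (fun _ => ((0 : ℝ), s))) ∂ρ := by
  have : IsProbabilityMeasure (ρ.map (fun s => ((0 : ℝ), s))) :=
    Measure.isProbabilityMeasure_map (by fun_prop)
  have hm := hf.lintegral_kernel (κ := Kernel.traj (X := fun _ : ℕ => ℝ × X)
      (fun n => M.step.comap
        (fun y : (i : Finset.Iic n) → ℝ × X => (y ⟨n, Finset.mem_Iic.2 le_rfl⟩).2) (by fun_prop)) 0)
  unfold law Kernel.trajMeasure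
  rw [Measure.lintegral_bind (Kernel.aemeasurable _) hf.aemeasurable]
  rw [lintegral_map hm (MeasurableEquiv.measurable _)]
  exact lintegral_map (f := fun a => ∫⁻ x, f x ∂(Kernel.traj (X := fun _ : ℕ => ℝ × X)
      (fun n => M.step.comap
        (fun y : (i : Finset.Iic n) → ℝ × X => (y ⟨n, Finset.mem_Iic.2 le_rfl⟩).2) (by fun_prop)) 0
      ((MeasurableEquiv.piUnique fun _ : Finset.Iic 0 => ℝ × X).symm a)))
    (hm.comp (MeasurableEquiv.measurable _)) (by fun_prop)

/-- The law of a trajectory is the mixture of the laws of the trajectories with a fixed start. -/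
lemma lintegral_law (ρ : Measure X) [IsProbabilityMeasure ρ] [DiscreteMeasurableSpace X]
    (f : Traj X → ℝ≥0∞) (hf : Measurable f) :
    ∫⁻ x, f x ∂(M.law ρ) = ∫⁻ s, ∫⁻ x, f x ∂(M.lawAt s) ∂ρ := by
  rw [lintegral_law_eq_traj M ρ f hf]
  refine lintegral_congr fun s => ?_
  rw [lawAt, lintegral_law_eq_traj M _ f hf, lintegral_dirac]

/-- The kernel generating trajectories from time 0 leaves the time-0 coordinate fixed, so its
marginal there is a Dirac mass. -/
lemma ae_lawAt_S_zero [DiscreteMeasurableSpace X] (s : X) :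
    ∀ᵐ x ∂(M.lawAt s), S 0 x = s := by
  have hm : MeasurableSet {x : Traj X | S 0 x ≠ s} :=
    (measurable_S 0) (MeasurableSet.of_discrete (s := {s}ᶜ))
  have hm' : MeasurableSet {y : (i : Finset.Iic 0) → ℝ × X |
      (y ⟨0, Finset.mem_Iic.2 le_rfl⟩).2 ≠ s} := by
    have : Measurable fun y : (i : Finset.Iic 0) → ℝ × X =>
      (y ⟨0, Finset.mem_Iic.2 le_rfl⟩).2 := by fun_prop
    exact this (MeasurableSet.of_discrete (s := {s}ᶜ))
  rw [ae_iff, ← lintegral_indicator_one hm, lawAt,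
    lintegral_law_eq_traj M _ _ (measurable_one.indicator hm), lintegral_dirac,
    lintegral_indicator_one hm]
  have h := Kernel.traj_map_frestrictLe_apply (X := fun _ : ℕ => ℝ × X)
    (κ := fun n => M.step.comap
        (fun y : (i : Finset.Iic n) → ℝ × X => (y ⟨n, Finset.mem_Iic.2 le_rfl⟩).2) (by fun_prop))
        0 0 (fun _ => ((0 : ℝ), s))
  rw [Kernel.partialTraj_self, Kernel.id_apply] at h
  have h2 := congrArg (fun m => m {y : (i : Finset.Iic 0) → ℝ × X |
      (y ⟨0, Finset.mem_Iic.2 le_rfl⟩).2 ≠ s}) h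
  rw [Measure.map_apply (by fun_prop) hm', Measure.dirac_apply' _ hm'] at h2
  simpa [S] using h2

end Law

/-! ### Absorption and almost sure regularity of trajectories -/

section Regular

variable {X : Type*} [MeasurableSpace X] (M : MRP X)

/-- Trajectories that are absorbed in the terminal state before the finite hitting time, collect no
reward from then on, and have rewards bounded by one. -/
def IsRegular (x : Traj X) : Prop :=
  (∃ K : ℕ, (K : ℝ) ≤ (M.hitTime x).toReal ∧ ∀ t, K ≤ t → S t x = M.term ∧ R t x = 0) ∧
    ∀ t, |R t x| ≤ 1

lemma measurable_hitTime [DiscreteMeasurableSpace X] : Measurable M.hitTime := by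
  unfold hitTime
  refine Measurable.iInf fun t => ?_
  have hm : MeasurableSet {x : Traj X | 0 < t ∧ S t x = M.term} :=
    (measurable_S t) (MeasurableSet.of_discrete (s := {s | 0 < t ∧ s = M.term}))
  have : (fun x : Traj X => ⨅ _ : 0 < t ∧ S t x = M.term, (t : ℝ≥0∞)) =
      fun x => by classical exact if 0 < t ∧ S t x = M.term then (t : ℝ≥0∞) else ∞ := by
    funext x
    by_cases h : 0 < t ∧ S t x = M.term <;> simp [h]
  rw [this]
  exact Measurable.ite hm measurable_const measurable_const

lemma hitTime_le {x : Traj X} {t : ℕ} (ht : 0 < t) (h : S t x = M.term) :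
    M.hitTime x ≤ t := iInf₂_le t ⟨ht, h⟩

lemma BoundedReward.ae_step {M : MRP X} (hR : M.BoundedReward) (s : X) :
    ∀ᵐ y ∂(M.step s), |y.1| ≤ 1 := by
  have h := hR s
  rw [← M.step_fst, Kernel.fst_apply] at h
  exact ae_of_ae_map (by fun_prop) h

variable [DiscreteMeasurableSpace X] [Countable X]

/-- Both marginals are Dirac masses, so the pair is almost surely constant whatever the coupling of
reward and next state. -/
lemma ae_reward_eq_zero_and_state_eq_term : ∀ᵐ y ∂(M.step M.term), y.1 = 0 ∧ y.2 = M.term := by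
  have h1 : (M.step M.term).map Prod.fst = Measure.dirac 0 := by
    rw [← M.reward_term, ← M.step_fst, Kernel.fst_apply]
  have h2 : (M.step M.term).map Prod.snd = Measure.dirac M.term := by
    rw [← M.trans_term, ← M.step_snd, Kernel.snd_apply]
  have h1' : ∀ᵐ r ∂((M.step M.term).map Prod.fst), r = 0 := by
    rw [h1, ae_dirac_eq]; simp
  have h2' : ∀ᵐ s ∂((M.step M.term).map Prod.snd), s = M.term := by
    rw [h2, ae_dirac_eq]; simp
  filter_upwards [ae_of_ae_map (by fun_prop) h1', ae_of_ae_map (by fun_prop) h2'] with y a b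
  exact ⟨a, b⟩

lemma ae_absorbed (ρ : Measure X) [IsProbabilityMeasure ρ] :
    ∀ᵐ x ∂(M.law ρ), ∀ t, S t x = M.term → R t x = 0 ∧ S (t + 1) x = M.term := by
  rw [ae_all_iff]
  intro t
  refine M.ae_law_of_ae_step ρ t (fun s y => s = M.term → y.1 = 0 ∧ y.2 = M.term) ?_ ?_
  · intro s
    by_cases h : s = M.term
    · simp only [h, forall_const]
      exact (measurable_fst (measurableSet_singleton 0)).inter
        (measurable_snd (MeasurableSet.of_discrete (s := {M.term})))
    · simp [h]
  · intro s
    by_cases h : s = M.term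
    · simpa [h] using M.ae_reward_eq_zero_and_state_eq_term
    · simp [h]

variable {M}

lemma BoundedReward.ae_law (hR : M.BoundedReward) (ρ : Measure X) [IsProbabilityMeasure ρ] :
    ∀ᵐ x ∂(M.law ρ), ∀ t, |R t x| ≤ 1 := by
  rw [ae_all_iff]
  intro t
  exact M.ae_law_of_ae_step ρ t (fun _ y => |y.1| ≤ 1)
    (fun _ => measurableSet_le (by fun_prop) measurable_const) hR.ae_step

end Regular

/-! ### Moments of the hitting time -/

section Moments

variable {X : Type*} [MeasurableSpace X] {M : MRP X} [DiscreteMeasurableSpace X] [Finite X] {h : ℝ}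

/-- The law is a mixture over finitely many starting states. The horizon assumption omits the start
in `∅`; there the hitting time, an infimum over `t > 0`, is at most one. -/
lemma EffHorizon.lintegral_hitTime_pow_lt_top (hEff : M.EffHorizon h) (ρ : Measure X)
    [IsProbabilityMeasure ρ] {p : ℕ} (hp : 1 ≤ p) :
    ∫⁻ x, M.hitTime x ^ p ∂(M.law ρ) < ∞ := by
  have : Fintype X := Fintype.ofFinite X
  rw [M.lintegral_law ρ _ (M.measurable_hitTime.pow_const p)]
  have key : ∀ s, ∫⁻ x, M.hitTime x ^ p ∂(M.lawAt s) < ∞ := by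
    intro s
    by_cases hs : s = M.term
    · have : ∀ᵐ x ∂(M.lawAt s), M.hitTime x ^ p ≤ 1 := by
        filter_upwards [M.ae_lawAt_S_zero s, M.ae_absorbed (Measure.dirac s)] with x h0 h1
        refine pow_le_one₀ zero_le ?_
        simpa using M.hitTime_le one_pos (h1 0 (h0.trans hs)).2
      calc _ ≤ ∫⁻ _, 1 ∂(M.lawAt s) := lintegral_mono_ae this
        _ < ∞ := by simp
    · exact (hEff s hs p hp).trans_lt ENNReal.ofReal_lt_top
  calc _ ≤ ∫⁻ _, ∑ s, ∫⁻ x, M.hitTime x ^ p ∂(M.lawAt s) ∂ρ :=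
        lintegral_mono fun s => Finset.single_le_sum
          (f := fun s => ∫⁻ x, M.hitTime x ^ p ∂(M.lawAt s))
          (fun _ _ => zero_le) (Finset.mem_univ s)
    _ < ∞ := by
      rw [lintegral_const, measure_univ, mul_one]
      exact ENNReal.sum_lt_top.2 fun s _ => key s

lemma EffHorizon.ae_hitTime_lt_top (hEff : M.EffHorizon h) (ρ : Measure X)
    [IsProbabilityMeasure ρ] : ∀ᵐ x ∂(M.law ρ), M.hitTime x < ∞ := by
  refine ae_lt_top M.measurable_hitTime ?_
  simpa using (hEff.lintegral_hitTime_pow_lt_top ρ le_rfl).ne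

lemma EffHorizon.integrable_hitTime_pow (hEff : M.EffHorizon h) (ρ : Measure X)
    [IsProbabilityMeasure ρ] {p : ℕ} (hp : 1 ≤ p) :
    Integrable (fun x => (M.hitTime x).toReal ^ p) (M.law ρ) := by
  simp_rw [← ENNReal.toReal_pow]
  exact integrable_toReal_of_lintegral_ne_top (M.measurable_hitTime.pow_const p).aemeasurable
    (hEff.lintegral_hitTime_pow_lt_top ρ hp).ne

lemma ae_isRegular (hEff : M.EffHorizon h) (hR : M.BoundedReward) (ρ : Measure X)
    [IsProbabilityMeasure ρ] : ∀ᵐ x ∂(M.law ρ), M.IsRegular x := by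
  filter_upwards [hEff.ae_hitTime_lt_top ρ, M.ae_absorbed ρ, hR.ae_law ρ] with x h1 h2 h3
  refine ⟨?_, h3⟩
  have hex : ∃ t, 0 < t ∧ S t x = M.term := by
    by_contra hc
    push Not at hc
    have : M.hitTime x = ∞ := by
      unfold hitTime
      simp only [iInf_eq_top]
      exact fun t ht => absurd ht.2 (hc t ht.1)
    exact h1.ne this
  classical
  refine ⟨Nat.find hex, ?_, ?_⟩
  · have : ((Nat.find hex : ℕ) : ℝ≥0∞) ≤ M.hitTime x :=
      le_iInf₂ fun t ht => by exact_mod_cast Nat.find_min' hex ht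
    simpa using ENNReal.toReal_mono h1.ne this
  · intro t ht
    have hS : S t x = M.term := by
      induction t, ht using Nat.le_induction with
      | base => exact (Nat.find_spec hex).2
      | succ t _ ih => exact (h2 t ih).2
    exact ⟨hS, (h2 t hS).1⟩

end Moments

/-! ### Integrability of the return and the Bellman equation -/

section Value

variable {X : Type*} [MeasurableSpace X] {M : MRP X}

lemma IsRegular.hasSum_R {x : Traj X} {K : ℕ} (hK : ∀ t, K ≤ t → S t x = M.term ∧ R t x = 0)
    (J : ℕ) (hJ : K ≤ J) : HasSum (fun t => R t x) (∑ t ∈ Finset.range J, R t x) :=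
  hasSum_sum_of_ne_finset_zero fun t ht =>
    (hK t (hJ.trans (by simpa using ht))).2

lemma IsRegular.tendsto_total {x : Traj X} (hx : M.IsRegular x) :
    Tendsto (fun J => ∑ t ∈ Finset.range J, R t x) atTop (𝓝 (total x)) := by
  obtain ⟨⟨K, -, hK⟩, -⟩ := hx
  exact (IsRegular.hasSum_R hK K le_rfl).summable.hasSum.tendsto_sum_nat

lemma IsRegular.summable {x : Traj X} (hx : M.IsRegular x) : Summable fun t => R t x := by
  obtain ⟨⟨K, -, hK⟩, -⟩ := hx
  exact (IsRegular.hasSum_R hK K le_rfl).summable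

/-- Only rewards before absorption count, each at most one in absolute value. The bound does not
depend on `J`, so it serves as the dominating function for the return. -/
lemma IsRegular.abs_sum_le {x : Traj X} (hx : M.IsRegular x) (J : ℕ) :
    |∑ t ∈ Finset.range J, R t x| ≤ (M.hitTime x).toReal := by
  obtain ⟨⟨K, hKT, hK⟩, h1⟩ := hx
  refine le_trans ?_ hKT
  calc |∑ t ∈ Finset.range J, R t x| ≤ ∑ t ∈ Finset.range J, |R t x| :=
        Finset.abs_sum_le_sum_abs _ _
    _ ≤ ∑ t ∈ Finset.range J, if t < K then (1 : ℝ) else 0 := by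
        refine Finset.sum_le_sum fun t _ => ?_
        split_ifs with ht
        · exact h1 t
        · rw [(hK t (not_lt.1 ht)).2, abs_zero]
    _ = ((Finset.range J).filter (· < K)).card := by simp
    _ ≤ (Finset.range K).card := by
        gcongr
        intro t ht
        simpa using (Finset.mem_filter.1 ht).2
    _ = K := by simp

variable [DiscreteMeasurableSpace X] [Finite X] {h : ℝ}

lemma aestronglyMeasurable_total (hEff : M.EffHorizon h) (hR : M.BoundedReward) (ρ : Measure X)
    [IsProbabilityMeasure ρ] : AEStronglyMeasurable (total : Traj X → ℝ) (M.law ρ) := by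
  refine aestronglyMeasurable_of_tendsto_ae atTop
    (f := fun J x => ∑ t ∈ Finset.range J, R t x) (fun J => ?_) ?_
  · exact (Finset.measurable_sum _ fun t _ => measurable_R t).aestronglyMeasurable
  · filter_upwards [ae_isRegular hEff hR ρ] with x hx using hx.tendsto_total

lemma integrable_total (hEff : M.EffHorizon h) (hR : M.BoundedReward) (ρ : Measure X)
    [IsProbabilityMeasure ρ] : Integrable (total : Traj X → ℝ) (M.law ρ) := by
  have hb := hEff.integrable_hitTime_pow ρ le_rfl
  simp only [pow_one] at hb
  refine hb.mono' (aestronglyMeasurable_total hEff hR ρ) ?_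
  filter_upwards [ae_isRegular hEff hR ρ] with x hx
  exact le_of_tendsto hx.tendsto_total.norm (Eventually.of_forall fun J => hx.abs_sum_le J)

lemma BoundedReward.integrable_R (hR : M.BoundedReward) (ρ : Measure X) [IsProbabilityMeasure ρ]
    (t : ℕ) : Integrable (fun x => R t x) (M.law ρ) := by
  refine (integrable_const (1 : ℝ)).mono' (measurable_R t).aestronglyMeasurable ?_
  filter_upwards [hR.ae_law ρ] with x hx using hx t

lemma integrable_comp_S (ρ : Measure X) [IsProbabilityMeasure ρ] (f : X → ℝ) (t : ℕ) :
    Integrable (fun x => f (S t x)) (M.law ρ) := by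
  obtain ⟨C, hC⟩ := (Set.finite_range fun s => ‖f s‖).bddAbove
  refine (integrable_const C).mono'
    (Measurable.of_discrete.comp (measurable_S t)).aestronglyMeasurable
    (ae_of_all _ fun x => hC ⟨_, rfl⟩)

variable (M) in
/-- The transition operator `f ↦ (s ↦ 𝔼_s[f(S_1)])`. -/
noncomputable def transOp (f : X → ℝ) (s : X) : ℝ := ∫ y, f y.2 ∂(M.step s)

variable (M) in
/-- The mean reward `𝔼_s[R_0]`. -/
noncomputable def meanReward (s : X) : ℝ := ∫ y, y.1 ∂(M.step s)

lemma transOp_eq_sum [Fintype X] (f : X → ℝ) (s : X) :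
    M.transOp f s = ∑ s', (M.step s).real {y | y.2 = s'} * f s' := by
  have hmap : M.transOp f s = ∫ s', f s' ∂((M.step s).map Prod.snd) := by
    rw [integral_map (by fun_prop) (by fun_prop)]; rfl
  have : IsProbabilityMeasure ((M.step s).map Prod.snd) :=
    Measure.isProbabilityMeasure_map (by fun_prop)
  rw [hmap, integral_fintype .of_finite]
  refine Finset.sum_congr rfl fun s' _ => ?_
  rw [map_measureReal_apply measurable_snd .of_discrete]
  rfl

lemma integral_comp_S_succ (ρ : Measure X) [IsProbabilityMeasure ρ] (f : X → ℝ) (t : ℕ) :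
    ∫ x, f (S (t + 1) x) ∂(M.law ρ) = ∫ x, M.transOp f (S t x) ∂(M.law ρ) := by
  have := M.integral_law_mul_step ρ t (fun _ => 1) measurable_const
    (fun _ _ _ => rfl) (fun _ y => f y.2) (fun _ => by fun_prop)
    (by simp only [one_mul]; exact integrable_comp_S ρ f (t + 1))
  simp only [one_mul] at this
  exact this

lemma integral_R (hR : M.BoundedReward) (ρ : Measure X) [IsProbabilityMeasure ρ] (t : ℕ) :
    ∫ x, R t x ∂(M.law ρ) = ∫ x, M.meanReward (S t x) ∂(M.law ρ) := by
  have := M.integral_law_mul_step ρ t (fun _ => 1) measurable_const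
    (fun _ _ _ => rfl) (fun _ y => y.1) (fun _ => by fun_prop)
    (by simp only [one_mul]; exact hR.integrable_R ρ t)
  simp only [one_mul] at this
  exact this

lemma integral_lawAt_comp_S (s : X) (f : X → ℝ) (t : ℕ) :
    ∫ x, f (S t x) ∂(M.lawAt s) = M.transOp^[t] f s := by
  induction t generalizing f with
  | zero =>
    rw [integral_congr_ae (g := fun _ => f s)]
    · simp
    · filter_upwards [M.ae_lawAt_S_zero s] with x hx using by rw [hx]
  | succ t ih =>
    rw [Function.iterate_succ_apply, ← ih]
    exact integral_comp_S_succ _ f t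

/-- Dominated convergence with `T_∅` as dominating function. Writing the value as a series in
iterates of the transition operator reduces the Bellman equation to algebra, with no Markov property
for shifted trajectories. -/
lemma tendsto_value (hEff : M.EffHorizon h) (hR : M.BoundedReward) (s : X) :
    Tendsto (fun J => ∑ t ∈ Finset.range J, M.transOp^[t] M.meanReward s) atTop
      (𝓝 (M.value s)) := by
  have hb := hEff.integrable_hitTime_pow (Measure.dirac s) le_rfl
  simp only [pow_one] at hb
  have key : Tendsto (fun J => ∫ x, ∑ t ∈ Finset.range J, R t x ∂(M.lawAt s)) atTop
      (𝓝 (∫ x, total x ∂(M.lawAt s))) := by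
    refine tendsto_integral_of_dominated_convergence _ (fun J => ?_) hb (fun J => ?_) ?_
    · exact (Finset.measurable_sum _ fun t _ => measurable_R t).aestronglyMeasurable
    · filter_upwards [ae_isRegular hEff hR (Measure.dirac s)] with x hx using hx.abs_sum_le J
    · filter_upwards [ae_isRegular hEff hR (Measure.dirac s)] with x hx using hx.tendsto_total
  refine key.congr fun J => ?_
  rw [lawAt, integral_finsetSum _ fun t _ => hR.integrable_R _ t]
  refine Finset.sum_congr rfl fun t _ => ?_
  rw [← integral_lawAt_comp_S]
  exact integral_R hR _ t

/-- The Bellman equation. -/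
lemma bellman (hEff : M.EffHorizon h) (hR : M.BoundedReward) (s : X) :
    M.meanReward s + M.transOp M.value s = M.value s := by
  have : Fintype X := Fintype.ofFinite X
  -- The operator is a finite sum over `X`, hence commutes with pointwise limits. Applied to a
  -- truncated series and with the mean reward added, it yields the truncation with one more term,
  -- so both sides are limits of the same sequence.
  have h1 : Tendsto (fun J => M.meanReward s + M.transOp
      (fun s' => ∑ t ∈ Finset.range J, M.transOp^[t] M.meanReward s') s) atTop
      (𝓝 (M.meanReward s + M.transOp M.value s)) := by
    simp only [transOp_eq_sum (M := M) _ s]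
    exact tendsto_const_nhds.add (tendsto_finsetSum _ fun s' _ =>
      (tendsto_value hEff hR s').const_mul _)
  have h2 := (tendsto_value hEff hR s).comp (tendsto_add_atTop_nat 1)
  refine tendsto_nhds_unique (h1.congr fun J => ?_) h2
  simp only [Function.comp_apply, Finset.sum_range_succ', Function.iterate_zero, id]
  rw [add_comm]
  congr 1
  rw [transOp_eq_sum]
  simp_rw [Finset.mul_sum]
  rw [Finset.sum_comm]
  refine Finset.sum_congr rfl fun t _ => ?_
  rw [Function.iterate_succ_apply', transOp_eq_sum]

lemma value_term (M : MRP X) : M.value M.term = 0 := by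
  unfold value
  rw [integral_congr_ae (g := fun _ => (0 : ℝ)), integral_zero]
  filter_upwards [M.ae_lawAt_S_zero M.term, M.ae_absorbed (Measure.dirac M.term)] with x h0 h1
  have hS : ∀ t, S t x = M.term := fun t => by
    induction t with
    | zero => exact h0
    | succ t ih => exact (h1 t ih).2
  simp [total, fun t => (h1 t (hS t)).1]

end Value

/-! ### Closure properties used to discharge integrability -/

section BoundedFunctional

variable {X : Type*} [MeasurableSpace X]

/-- Measurable functionals that are bounded on the trajectories with rewards bounded by one. -/
def IsBoundedFunctional (f : Traj X → ℝ) : Prop :=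
  Measurable f ∧ ∃ C : ℝ, ∀ x, (∀ t, |R t x| ≤ 1) → |f x| ≤ C

namespace IsBoundedFunctional

lemma mul {f g : Traj X → ℝ} (hf : IsBoundedFunctional f) (hg : IsBoundedFunctional g) :
    IsBoundedFunctional fun x => f x * g x := by
  obtain ⟨hf, C, hC⟩ := hf
  obtain ⟨hg, D, hD⟩ := hg
  refine ⟨hf.mul hg, C * D, fun x hx => ?_⟩
  rw [abs_mul]
  exact mul_le_mul (hC x hx) (hD x hx) (abs_nonneg _) ((abs_nonneg _).trans (hC x hx))

lemma add {f g : Traj X → ℝ} (hf : IsBoundedFunctional f) (hg : IsBoundedFunctional g) :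
    IsBoundedFunctional fun x => f x + g x := by
  obtain ⟨hf, C, hC⟩ := hf
  obtain ⟨hg, D, hD⟩ := hg
  exact ⟨hf.add hg, C + D, fun x hx => (abs_add_le _ _).trans (add_le_add (hC x hx) (hD x hx))⟩

lemma sub {f g : Traj X → ℝ} (hf : IsBoundedFunctional f) (hg : IsBoundedFunctional g) :
    IsBoundedFunctional fun x => f x - g x := by
  obtain ⟨hf, C, hC⟩ := hf
  obtain ⟨hg, D, hD⟩ := hg
  exact ⟨hf.sub hg, C + D, fun x hx => (abs_sub _ _).trans (add_le_add (hC x hx) (hD x hx))⟩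

lemma sum {ι : Type*} {f : ι → Traj X → ℝ} (A : Finset ι) (hf : ∀ i, IsBoundedFunctional (f i)) :
    IsBoundedFunctional fun x => ∑ i ∈ A, f i x := by
  choose hm C hC using hf
  exact ⟨Finset.measurable_sum _ fun i _ => hm i, ∑ i ∈ A, C i, fun x hx =>
    (Finset.abs_sum_le_sum_abs _ _).trans (Finset.sum_le_sum fun i _ => hC i x hx)⟩

lemma comp_S [DiscreteMeasurableSpace X] [Finite X] (f : X → ℝ) (t : ℕ) :
    IsBoundedFunctional fun x : Traj X => f (S t x) := by
  obtain ⟨C, hC⟩ := (Set.finite_range fun s => |f s|).bddAbove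
  exact ⟨Measurable.of_discrete.comp (measurable_S t), C, fun x _ => hC ⟨_, rfl⟩⟩

lemma reward (t : ℕ) : IsBoundedFunctional fun x : Traj X => R t x :=
  ⟨measurable_R t, 1, fun _ hx => hx t⟩

lemma integrable {M : MRP X} [DiscreteMeasurableSpace X] [Finite X] {f : Traj X → ℝ}
    (hf : IsBoundedFunctional f) (hR : M.BoundedReward) (ρ : Measure X)
    [IsProbabilityMeasure ρ] : Integrable f (M.law ρ) := by
  obtain ⟨hf, C, hC⟩ := hf
  refine (integrable_const C).mono' hf.aestronglyMeasurable ?_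
  filter_upwards [hR.ae_law ρ] with x hx using hC x hx

end IsBoundedFunctional

end BoundedFunctional

/-! ### Visit counts -/

section Visits

variable {X : Type*}

/-- The indicator of a visit of `s` at time `t`. -/
noncomputable def visitAt (s : X) (t : ℕ) (x : Traj X) : ℝ :=
  Set.indicator {y : Traj X | S t y = s} (fun _ => (1 : ℝ)) x

/-- The number of visits of `s` up to and including time `j`. -/
noncomputable def visitsUpTo (s : X) (j : ℕ) (x : Traj X) : ℝ :=
  ∑ t ∈ Finset.range (j + 1), visitAt s t x

lemma visitAt_nonneg (s : X) (t : ℕ) (x : Traj X) : 0 ≤ visitAt s t x :=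
  Set.indicator_nonneg (fun _ _ => zero_le_one) _

lemma visitAt_le_one (s : X) (t : ℕ) (x : Traj X) : visitAt s t x ≤ 1 :=
  Set.indicator_le' (fun _ _ => le_rfl) (fun _ _ => zero_le_one) _

lemma visitAt_eq (s : X) (t : ℕ) (x : Traj X) :
    visitAt s t x = Set.indicator {s} (fun _ => (1 : ℝ)) (S t x) := by
  by_cases h : S t x = s <;> simp [visitAt, h]

lemma visitAt_of_ne {s : X} {t : ℕ} {x : Traj X} (h : S t x ≠ s) : visitAt s t x = 0 := by
  simp [visitAt, h]

lemma visitsUpTo_nonneg (s : X) (j : ℕ) (x : Traj X) : 0 ≤ visitsUpTo s j x :=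
  Finset.sum_nonneg fun t _ => visitAt_nonneg s t x

lemma visitsUpTo_le (s : X) (j : ℕ) (x : Traj X) : visitsUpTo s j x ≤ j + 1 := by
  calc visitsUpTo s j x ≤ ∑ t ∈ Finset.range (j + 1), (1 : ℝ) :=
        Finset.sum_le_sum fun t _ => visitAt_le_one s t x
    _ = j + 1 := by simp

lemma dependsOn_visitsUpTo (s : X) (j : ℕ) :
    DependsOn (visitsUpTo s j : Traj X → ℝ) (Set.Iic j) := by
  intro x y hxy
  refine Finset.sum_congr rfl fun t ht => ?_
  have : S t x = S t y := congrArg Prod.snd (hxy t (Nat.lt_succ_iff.1 (Finset.mem_range.1 ht)))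
  rw [visitAt_eq, visitAt_eq, this]

end Visits

/-! ### The martingale representation of the centred rollout sum -/

section Residual

variable {X : Type*} [MeasurableSpace X] (M : MRP X)

/-- The temporal difference error `R_j + V⋆(S_{j+1}) - V⋆(S_j)`. -/
noncomputable def tdError (j : ℕ) (x : Traj X) : ℝ :=
  R j x + M.value (S (j + 1) x) - M.value (S j x)

/-- The martingale `∑_{j < J} (R_j + V⋆(S_{j+1}) - V⋆(S_j)) N_j(s)`, where `N_j(s)` is the number of
visits of `s` up to time `j`. -/
noncomputable def residualMart (s : X) (J : ℕ) (x : Traj X) : ℝ :=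
  ∑ j ∈ Finset.range J, M.tdError j x * visitsUpTo s j x

/-- The centred rollout sum `∑_t 1{S_t = s} (∑_{ℓ ≥ t} R_ℓ - V⋆(s))`. -/
noncomputable def residual (s : X) (x : Traj X) : ℝ :=
  rolloutSum s x - M.value s * visits s x

variable {M}

section Pathwise

variable {x : Traj X} {K J : ℕ}

lemma hasSum_visitAt (hK : ∀ t, K ≤ t → S t x = M.term ∧ R t x = 0)
    (hJ : K ≤ J) {s : X} (hs : s ≠ M.term) :
    HasSum (fun t => visitAt s t x) (∑ t ∈ Finset.range J, visitAt s t x) :=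
  hasSum_sum_of_ne_finset_zero fun t ht => visitAt_of_ne <| by
    rw [(hK t (hJ.trans (by simpa using ht))).1]; exact hs.symm

lemma total_shift_eq (hK : ∀ t, K ≤ t → S t x = M.term ∧ R t x = 0)
    (hJ : K ≤ J) {t : ℕ} :
    total (shift t x) = ∑ j ∈ Finset.Ico t J, R j x := by
  rw [Finset.sum_Ico_eq_sum_range]
  have h : ∀ l, R l (shift t x) = R (t + l) x := fun l => rfl
  simp only [total, h]
  refine tsum_eq_sum fun l hl => (hK _ ?_).2
  simp only [Finset.mem_range] at hl
  omega

lemma sum_tdError_Ico {t : ℕ} (ht : t ≤ J) :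
    ∑ j ∈ Finset.Ico t J, M.tdError j x =
      ∑ j ∈ Finset.Ico t J, R j x + M.value (S J x) - M.value (S t x) := by
  induction J, ht using Nat.le_induction with
  | base => simp
  | succ J hJ ih =>
    rw [Finset.sum_Ico_succ_top hJ, Finset.sum_Ico_succ_top hJ, ih, tdError]
    ring

/-- The return after `t` minus `V⋆(S_t)` telescopes into temporal difference errors, the boundary
term being the value at `∅`, which is zero. Summing over the visit times `t` first then collects
`N_j(s)` in front of the `j`-th error. -/
lemma residual_eq_residualMart [DiscreteMeasurableSpace X] [Finite X]
    (hK : ∀ t, K ≤ t → S t x = M.term ∧ R t x = 0)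
    (hJ : K ≤ J) {s : X} (hs : s ≠ M.term) :
    M.residual s x = M.residualMart s J x := by
  have h1 : rolloutSum s x =
      ∑ t ∈ Finset.range J, visitAt s t x * total (shift t x) := by
    unfold rolloutSum
    rw [tsum_eq_sum (s := Finset.range J)]
    · refine Finset.sum_congr rfl fun t _ => ?_
      by_cases h : S t x = s <;> simp [visitAt, h]
    · intro t ht
      have : S t x ≠ s := by
        rw [(hK t (hJ.trans (by simpa using ht))).1]; exact hs.symm
      simp [this]
  have h2 : visits s x = ∑ t ∈ Finset.range J, visitAt s t x :=
    (hasSum_visitAt hK hJ hs).tsum_eq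
  have h3 : M.residual s x = ∑ t ∈ Finset.range J, ∑ j ∈ Finset.Ico t J,
      M.tdError j x * visitAt s t x := by
    rw [residual, h1, h2, Finset.mul_sum, ← Finset.sum_sub_distrib]
    refine Finset.sum_congr rfl fun t ht => ?_
    rw [← Finset.sum_mul, sum_tdError_Ico (Finset.mem_range.1 ht).le, (hK J hJ).1, M.value_term,
      total_shift_eq hK hJ]
    by_cases h : S t x = s
    · rw [h]; ring
    · rw [visitAt_of_ne h]; ring
  rw [h3, residualMart]
  simp_rw [visitsUpTo, Finset.mul_sum]
  -- Both orders of summation range over the triangle `t ≤ j < J`.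
  refine Finset.sum_comm' fun t j => ?_
  simp only [Finset.mem_range, Finset.mem_Ico]
  omega

end Pathwise

lemma IsRegular.eventually_residualMart_eq [DiscreteMeasurableSpace X] [Finite X]
    {x : Traj X} (hx : M.IsRegular x) {s : X}
    (hs : s ≠ M.term) : ∀ᶠ J in atTop, M.residualMart s J x = M.residual s x := by
  obtain ⟨⟨K, -, hK⟩, -⟩ := hx
  filter_upwards [eventually_ge_atTop K] with J hJ using (residual_eq_residualMart hK hJ hs).symm

lemma residualMart_succ (s : X) (J : ℕ) (x : Traj X) :
    M.residualMart s (J + 1) x = M.residualMart s J x + M.tdError J x * visitsUpTo s J x :=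
  Finset.sum_range_succ _ _

lemma IsRegular.tendsto_residualMart [DiscreteMeasurableSpace X] [Finite X]
    {x : Traj X} (hx : M.IsRegular x) {s : X}
    (hs : s ≠ M.term) :
    Tendsto (fun J => M.residualMart s J x) atTop (𝓝 (M.residual s x)) :=
  tendsto_const_nhds.congr' ((hx.eventually_residualMart_eq hs).mono fun _ h => h.symm)

lemma IsRegular.hasSum_visitAt {x : Traj X} (hx : M.IsRegular x) {s : X} (hs : s ≠ M.term) :
    HasSum (fun t => visitAt s t x) (visits s x) := by
  obtain ⟨⟨K, -, hK⟩, -⟩ := hx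
  exact (MRP.hasSum_visitAt hK le_rfl hs).summable.hasSum

lemma IsRegular.visits_le {x : Traj X} (hx : M.IsRegular x) {s : X} (hs : s ≠ M.term) :
    visits s x ≤ (M.hitTime x).toReal := by
  obtain ⟨⟨K, hKT, hK⟩, -⟩ := hx
  refine le_trans ?_ hKT
  rw [show visits s x = _ from (MRP.hasSum_visitAt hK le_rfl hs).tsum_eq]
  calc _ ≤ ∑ t ∈ Finset.range K, (1 : ℝ) := Finset.sum_le_sum fun t _ => visitAt_le_one s t x
    _ = K := by simp

variable (M) in
-- At most `K ≤ T_∅` temporal difference errors are nonzero, each is bounded since `V⋆` is bounded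
-- on a finite space, and each is weighted by a visit count of at most `K`.
lemma exists_abs_residualMart_le [DiscreteMeasurableSpace X] [Finite X] :
    ∃ C : ℝ, 0 ≤ C ∧ ∀ x, M.IsRegular x → ∀ s J,
    |M.residualMart s J x| ≤ C * (M.hitTime x).toReal ^ 2 := by
  obtain ⟨B, hB⟩ := (Set.finite_range fun s => |M.value s|).bddAbove
  have hB : ∀ s, |M.value s| ≤ B := fun s => hB ⟨s, rfl⟩
  have hB0 : 0 ≤ B := (abs_nonneg _).trans (hB M.term)
  refine ⟨1 + B + B, by positivity, ?_⟩
  rintro x ⟨⟨K, hKT, hK⟩, h1⟩ s J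
  have htd : ∀ j, |M.tdError j x| ≤ 1 + B + B := fun j =>
    (abs_sub _ _).trans (add_le_add ((abs_add_le _ _).trans (add_le_add (h1 j) (hB _))) (hB _))
  have hterm : ∀ j, |M.tdError j x * visitsUpTo s j x| ≤
      if j < K then (1 + B + B) * (K : ℝ) else 0 := by
    intro j
    split_ifs with hj
    · rw [abs_mul, abs_of_nonneg (visitsUpTo_nonneg s j x)]
      refine mul_le_mul (htd j) ((visitsUpTo_le s j x).trans ?_) (visitsUpTo_nonneg s j x)
        (by positivity)
      exact_mod_cast hj
    · have hj := not_lt.1 hj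
      simp [tdError, (hK j hj).1, (hK j hj).2, (hK (j + 1) (by omega)).1, M.value_term]
  calc |M.residualMart s J x| ≤ ∑ j ∈ Finset.range J, |M.tdError j x * visitsUpTo s j x| :=
        Finset.abs_sum_le_sum_abs _ _
    _ ≤ ∑ j ∈ Finset.range J, if j < K then (1 + B + B) * (K : ℝ) else 0 :=
        Finset.sum_le_sum fun j _ => hterm j
    _ = ((Finset.range J).filter (· < K)).card * ((1 + B + B) * (K : ℝ)) := by
        rw [← Finset.sum_filter, Finset.sum_const, nsmul_eq_mul]
    _ ≤ (Finset.range K).card * ((1 + B + B) * (K : ℝ)) := by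
        gcongr
        intro t ht
        simpa using (Finset.mem_filter.1 ht).2
    _ = (1 + B + B) * (K : ℝ) ^ 2 := by rw [Finset.card_range]; ring
    _ ≤ _ := by gcongr

/-- The last error in the sum has index `J - 1` and involves `R_{J-1}` and `S_J`, which are stored
together in coordinate `J`; hence the martingale is adapted with no shift of index. -/
lemma dependsOn_residualMart (s : X) (J : ℕ) :
    DependsOn (M.residualMart s J) (Set.Iic J) := by
  intro x y hxy
  refine Finset.sum_congr rfl fun j hj => ?_
  have hj := Finset.mem_range.1 hj
  have e1 : x (j + 1) = y (j + 1) := hxy _ hj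
  have e0 : x j = y j := hxy _ hj.le
  have e2 : visitsUpTo s j x = visitsUpTo s j y :=
    dependsOn_visitsUpTo s j fun t ht => hxy t (le_trans ht hj.le)
  rw [e2]
  simp [tdError, R, S, e1, e0]

variable [DiscreteMeasurableSpace X] [Finite X]

lemma isBoundedFunctional_visitAt (s : X) (t : ℕ) :
    IsBoundedFunctional (visitAt s t : Traj X → ℝ) := by
  have : (visitAt s t : Traj X → ℝ) = fun x => Set.indicator {s} (fun _ => (1 : ℝ)) (S t x) :=
    funext fun x => visitAt_eq s t x
  rw [this]
  exact .comp_S _ t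

lemma isBoundedFunctional_visitsUpTo (s : X) (j : ℕ) :
    IsBoundedFunctional (visitsUpTo s j : Traj X → ℝ) :=
  .sum _ fun t => isBoundedFunctional_visitAt s t

variable (M) in
lemma isBoundedFunctional_tdError (j : ℕ) : IsBoundedFunctional (M.tdError j) :=
  ((IsBoundedFunctional.reward j).add (.comp_S M.value (j + 1))).sub (.comp_S M.value j)

variable (M) in
lemma isBoundedFunctional_residualMart (s : X) (J : ℕ) :
    IsBoundedFunctional (M.residualMart s J) :=
  .sum _ fun j => (M.isBoundedFunctional_tdError j).mul (isBoundedFunctional_visitsUpTo s j)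

variable {h : ℝ}

variable (M) in
/-- The variance of `R_0 + V⋆(S_1)` given `S_0 = s`, as an integral against the step kernel. -/
noncomputable def stepVar (s : X) : ℝ :=
  ∫ y, (y.1 + M.value y.2 - M.value s) ^ 2 ∂(M.step s)

lemma integral_tdError_step (hEff : M.EffHorizon h) (hR : M.BoundedReward) (s : X) :
    ∫ y, (y.1 + M.value y.2 - M.value s) ∂(M.step s) = 0 := by
  have i1 : Integrable (fun y : ℝ × X => y.1) (M.step s) :=
    (integrable_const (1 : ℝ)).mono' (by fun_prop) (hR.ae_step s)
  have i2 : Integrable (fun y : ℝ × X => M.value y.2) (M.step s) := by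
    obtain ⟨B, hB⟩ := (Set.finite_range fun s => |M.value s|).bddAbove
    exact (integrable_const B).mono'
      ((Measurable.of_discrete (f := M.value)).comp measurable_snd).aestronglyMeasurable
      (ae_of_all _ fun y => hB ⟨_, rfl⟩)
  rw [integral_sub (f := fun y : ℝ × X => y.1 + M.value y.2) (i1.add i2) (integrable_const _),
    integral_add i1 i2]
  have := bellman hEff hR s
  unfold meanReward transOp at this
  simp [this]

/-- The martingale difference property: conditionally on the history up to `S_j`, the error has mean
zero by the Bellman equation. -/
lemma integral_mul_tdError (hEff : M.EffHorizon h) (hR : M.BoundedReward) (ρ : Measure X)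
    [IsProbabilityMeasure ρ] {F : Traj X → ℝ} {j : ℕ} (hF : IsBoundedFunctional F)
    (hdep : DependsOn F (Set.Iic j)) :
    ∫ x, F x * M.tdError j x ∂(M.law ρ) = 0 := by
  have := M.integral_law_mul_step ρ j F hF.1 hdep
    (fun s y => y.1 + M.value y.2 - M.value s) (fun _ => by fun_prop)
    ((hF.mul (M.isBoundedFunctional_tdError j)).integrable hR ρ)
  simp only [integral_tdError_step hEff hR, mul_zero, integral_zero] at this
  exact this

lemma integral_mul_tdError_sq (hR : M.BoundedReward) (ρ : Measure X)
    [IsProbabilityMeasure ρ] {F : Traj X → ℝ} {j : ℕ} (hF : IsBoundedFunctional F)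
    (hdep : DependsOn F (Set.Iic j)) :
    ∫ x, F x * M.tdError j x ^ 2 ∂(M.law ρ) = ∫ x, F x * M.stepVar (S j x) ∂(M.law ρ) := by
  refine M.integral_law_mul_step ρ j F hF.1 hdep
    (fun s y => (y.1 + M.value y.2 - M.value s) ^ 2) (fun _ => by fun_prop) ?_
  have := (hF.mul ((M.isBoundedFunctional_tdError j).mul
    (M.isBoundedFunctional_tdError j))).integrable hR ρ
  simp only [← pow_two] at this
  exact this

lemma integral_residualMart (hEff : M.EffHorizon h) (hR : M.BoundedReward) (ρ : Measure X)
    [IsProbabilityMeasure ρ] (s : X) (J : ℕ) :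
    ∫ x, M.residualMart s J x ∂(M.law ρ) = 0 := by
  induction J with
  | zero => simp [residualMart]
  | succ J ih =>
    simp_rw [residualMart_succ, mul_comm (M.tdError J _)]
    rw [integral_add ((M.isBoundedFunctional_residualMart s J).integrable hR ρ)
      (((isBoundedFunctional_visitsUpTo s J).mul (M.isBoundedFunctional_tdError J)).integrable hR ρ),
      ih, integral_mul_tdError hEff hR ρ (isBoundedFunctional_visitsUpTo s J)
        (dependsOn_visitsUpTo s J), add_zero]

/-- Orthogonality of increments: in the product at `J + 1` the terms linear in the new error
integrate to zero, and its square may be replaced by the conditional variance. -/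
lemma integral_residualMart_mul (hEff : M.EffHorizon h) (hR : M.BoundedReward) (ρ : Measure X)
    [IsProbabilityMeasure ρ] (s s' : X) (J : ℕ) :
    ∫ x, M.residualMart s J x * M.residualMart s' J x ∂(M.law ρ) =
      ∑ j ∈ Finset.range J,
        ∫ x, visitsUpTo s j x * visitsUpTo s' j x * M.stepVar (S j x) ∂(M.law ρ) := by
  induction J with
  | zero => simp [residualMart]
  | succ J ih =>
    have b := M.isBoundedFunctional_tdError J
    have bm := M.isBoundedFunctional_residualMart s J
    have bm' := M.isBoundedFunctional_residualMart s' J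
    have bn := isBoundedFunctional_visitsUpTo s J
    have bn' := isBoundedFunctional_visitsUpTo s' J
    have bc := (bm.mul bn').add (bm'.mul bn)
    have dn := dependsOn_visitsUpTo s J
    have dn' := dependsOn_visitsUpTo s' J
    have dm := dependsOn_residualMart (M := M) s J
    have dm' := dependsOn_residualMart (M := M) s' J
    have e : ∀ x, M.residualMart s (J + 1) x * M.residualMart s' (J + 1) x =
        M.residualMart s J x * M.residualMart s' J x +
        (M.residualMart s J x * visitsUpTo s' J x + M.residualMart s' J x * visitsUpTo s J x) *
          M.tdError J x +
        visitsUpTo s J x * visitsUpTo s' J x * M.tdError J x ^ 2 := fun x => by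
      rw [residualMart_succ, residualMart_succ]; ring
    have i3 : Integrable (fun x => visitsUpTo s J x * visitsUpTo s' J x * M.tdError J x ^ 2)
        (M.law ρ) := by
      have := ((bn.mul bn').mul (b.mul b)).integrable hR ρ
      simp only [← pow_two] at this
      exact this
    simp_rw [e]
    rw [integral_add (((bm.mul bm').add (bc.mul b)).integrable hR ρ) i3,
      integral_add ((bm.mul bm').integrable hR ρ) ((bc.mul b).integrable hR ρ), ih,
      integral_mul_tdError hEff hR ρ bc ?_, integral_mul_tdError_sq hR ρ (bn.mul bn') ?_,
      Finset.sum_range_succ, add_zero]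
    · intro x y hxy
      simp only [dn hxy, dn' hxy]
    · intro x y hxy
      simp only [dn hxy, dn' hxy, dm hxy, dm' hxy]

lemma aestronglyMeasurable_residual (hEff : M.EffHorizon h) (hR : M.BoundedReward) (ρ : Measure X)
    [IsProbabilityMeasure ρ] {s : X} (hs : s ≠ M.term) :
    AEStronglyMeasurable (M.residual s) (M.law ρ) := by
  refine aestronglyMeasurable_of_tendsto_ae atTop (f := fun J => M.residualMart s J)
    (fun J => (M.isBoundedFunctional_residualMart s J).1.aestronglyMeasurable) ?_
  filter_upwards [ae_isRegular hEff hR ρ] with x hx using hx.tendsto_residualMart hs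

lemma memLp_residual (hEff : M.EffHorizon h) (hR : M.BoundedReward) (ρ : Measure X)
    [IsProbabilityMeasure ρ] {s : X} (hs : s ≠ M.term) :
    MemLp (M.residual s) 2 (M.law ρ) := by
  obtain ⟨C, -, hC⟩ := M.exists_abs_residualMart_le
  -- Square integrability of the bound is finiteness of the fourth moment of `T_∅`.
  have hb : MemLp (fun x => C * (M.hitTime x).toReal ^ 2) 2 (M.law ρ) := by
    refine MemLp.const_mul ?_ C
    rw [memLp_two_iff_integrable_sq
      (M.measurable_hitTime.ennreal_toReal.pow_const 2).aestronglyMeasurable]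
    simp_rw [← pow_mul]
    exact hEff.integrable_hitTime_pow ρ (by norm_num)
  refine hb.of_le (aestronglyMeasurable_residual hEff hR ρ hs) ?_
  filter_upwards [ae_isRegular hEff hR ρ] with x hx
  exact (le_of_tendsto (hx.tendsto_residualMart hs).norm
    (Eventually.of_forall fun J => hC x hx s J)).trans (le_abs_self _)

lemma integral_residual (hEff : M.EffHorizon h) (hR : M.BoundedReward) (ρ : Measure X)
    [IsProbabilityMeasure ρ] {s : X} (hs : s ≠ M.term) :
    ∫ x, M.residual s x ∂(M.law ρ) = 0 := by
  obtain ⟨C, -, hC⟩ := M.exists_abs_residualMart_le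
  have : Tendsto (fun J => ∫ x, M.residualMart s J x ∂(M.law ρ)) atTop
      (𝓝 (∫ x, M.residual s x ∂(M.law ρ))) := by
    refine tendsto_integral_of_dominated_convergence _
      (fun J => (M.isBoundedFunctional_residualMart s J).1.aestronglyMeasurable)
      ((hEff.integrable_hitTime_pow ρ (p := 2) (by norm_num)).const_mul C) (fun J => ?_) ?_
    · filter_upwards [ae_isRegular hEff hR ρ] with x hx using hC x hx s J
    · filter_upwards [ae_isRegular hEff hR ρ] with x hx using hx.tendsto_residualMart hs
  simp only [integral_residualMart hEff hR] at this
  exact tendsto_nhds_unique this tendsto_const_nhds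

lemma tendsto_integral_residual_mul (hEff : M.EffHorizon h) (hR : M.BoundedReward) (ρ : Measure X)
    [IsProbabilityMeasure ρ] {s s' : X} (hs : s ≠ M.term) (hs' : s' ≠ M.term) :
    Tendsto (fun J => ∑ j ∈ Finset.range J,
        ∫ x, visitsUpTo s j x * visitsUpTo s' j x * M.stepVar (S j x) ∂(M.law ρ)) atTop
      (𝓝 (∫ x, M.residual s x * M.residual s' x ∂(M.law ρ))) := by
  obtain ⟨C, hC0, hC⟩ := M.exists_abs_residualMart_le
  simp_rw [← integral_residualMart_mul hEff hR]
  refine tendsto_integral_of_dominated_convergence _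
    (fun J => ((M.isBoundedFunctional_residualMart s J).mul
      (M.isBoundedFunctional_residualMart s' J)).1.aestronglyMeasurable)
    ((hEff.integrable_hitTime_pow ρ (p := 4) (by norm_num)).const_mul (C ^ 2)) (fun J => ?_) ?_
  · filter_upwards [ae_isRegular hEff hR ρ] with x hx
    rw [norm_mul, show C ^ 2 * (M.hitTime x).toReal ^ 4 =
      (C * (M.hitTime x).toReal ^ 2) * (C * (M.hitTime x).toReal ^ 2) by ring]
    exact mul_le_mul (hC x hx s J) (hC x hx s' J) (abs_nonneg _) (by positivity)
  · filter_upwards [ae_isRegular hEff hR ρ] with x hx using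
      (hx.tendsto_residualMart hs).mul (hx.tendsto_residualMart hs')

end Residual
end MRP

/-! ### The asymptotic covariance as a second moment -/

lemma ENNReal.tsum_tsum_tsum_max_le (b : ℕ → ℕ → ℕ → ℝ≥0∞) :
    ∑' t : ℕ, ∑' t' : ℕ, ∑' j : {j : ℕ // max t t' ≤ j}, b t t' j =
      ∑' j : ℕ, ∑ t ∈ Finset.range (j + 1), ∑ t' ∈ Finset.range (j + 1), b t t' j := by
  have h1 : ∀ t t' : ℕ, ∑' j : {j : ℕ // max t t' ≤ j}, b t t' j =
      ∑' j : ℕ, Set.indicator {j | max t t' ≤ j} (fun j => b t t' j) j := fun t t' =>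
    tsum_subtype {j | max t t' ≤ j} (fun j => b t t' j)
  simp_rw [h1]
  have h2 : ∀ t : ℕ, ∑' t' : ℕ, ∑' j : ℕ, Set.indicator {j | max t t' ≤ j} (fun j => b t t' j) j =
      ∑' j : ℕ, ∑' t' : ℕ, Set.indicator {j | max t t' ≤ j} (fun j => b t t' j) j := fun t =>
    ENNReal.tsum_comm
  simp_rw [h2]
  rw [ENNReal.tsum_comm]
  refine tsum_congr fun j => ?_
  rw [tsum_eq_sum (s := Finset.range (j + 1))]
  · refine Finset.sum_congr rfl fun t ht => ?_
    rw [tsum_eq_sum (s := Finset.range (j + 1))]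
    · refine Finset.sum_congr rfl fun t' ht' => Set.indicator_of_mem ?_ _
      simp only [Finset.mem_range] at ht ht'
      simp only [Set.mem_ofPred_eq]
      omega
    · intro t' ht'
      refine Set.indicator_of_notMem ?_ _
      simp only [Finset.mem_range] at ht'
      simp only [Set.mem_ofPred_eq]
      omega
  · intro t ht
    rw [ENNReal.tsum_eq_zero]
    intro t'
    refine Set.indicator_of_notMem ?_ _
    simp only [Finset.mem_range] at ht
    simp only [Set.mem_ofPred_eq]
    omega

namespace MRP

section Covariance

variable {X : Type*} [MeasurableSpace X] {M : MRP X}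

lemma stepVar_nonneg (M : MRP X) (s : X) : 0 ≤ M.stepVar s :=
  integral_nonneg fun _ => sq_nonneg _

variable [DiscreteMeasurableSpace X] [Finite X] {h : ℝ}

/-- This is why the sum over `s''` in the covariance may leave out the terminal state. -/
lemma stepVar_term (M : MRP X) : M.stepVar M.term = 0 := by
  unfold stepVar
  rw [integral_congr_ae (g := fun _ => (0 : ℝ)), integral_zero]
  filter_upwards [M.ae_reward_eq_zero_and_state_eq_term] with y hy
  simp [hy.1, hy.2]

/-- Since `S_0 = s` almost surely, `R_0 + V⋆(S_1)` has mean `V⋆(s)` by the Bellman equation, and its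
variance is the second moment of the first temporal difference error. -/
lemma oneStepVar_eq (hEff : M.EffHorizon h) (hR : M.BoundedReward) (s : X) :
    M.oneStepVar s = ENNReal.ofReal (M.stepVar s) := by
  have hb : IsBoundedFunctional fun x : Traj X => R 0 x + M.value (S 1 x) :=
    (IsBoundedFunctional.reward 0).add (.comp_S M.value 1)
  have htd : ∀ᵐ x ∂(M.lawAt s), R 0 x + M.value (S 1 x) - M.value s = M.tdError 0 x := by
    filter_upwards [M.ae_lawAt_S_zero s] with x hx
    simp [tdError, hx]
  have hone : IsBoundedFunctional fun _ : Traj X => (1 : ℝ) :=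
    ⟨measurable_const, 1, fun _ _ => by simp⟩
  have hint : Integrable (fun x : Traj X => R 0 x + M.value (S 1 x)) (M.lawAt s) :=
    hb.integrable hR _
  have hmean : ∫ x, (R 0 x + M.value (S 1 x)) ∂(M.lawAt s) = M.value s := by
    have h1 := integral_mul_tdError hEff hR (Measure.dirac s) (j := 0) hone (fun _ _ _ => rfl)
    simp only [one_mul] at h1
    rw [show M.law (Measure.dirac s) = M.lawAt s from rfl, ← integral_congr_ae htd,
      integral_sub hint (integrable_const _)] at h1
    simpa [sub_eq_zero] using h1
  have hL2 : MemLp (fun x : Traj X => R 0 x + M.value (S 1 x)) 2 (M.lawAt s) := by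
    rw [memLp_two_iff_integrable_sq hb.1.aestronglyMeasurable]
    simp only [pow_two]
    exact (hb.mul hb).integrable hR _
  rw [oneStepVar, ← hL2.ofReal_variance_eq, variance_eq_integral hb.1.aemeasurable, hmean]
  congr 1
  have h2 := integral_mul_tdError_sq hR (Measure.dirac s) (j := 0) hone (fun _ _ _ => rfl)
  simp only [one_mul] at h2
  calc _ = ∫ x, M.tdError 0 x ^ 2 ∂(M.lawAt s) := by
        refine integral_congr_ae ?_
        filter_upwards [htd] with x hx
        simp only [hx]
    _ = ∫ x, M.stepVar (S 0 x) ∂(M.lawAt s) := h2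
    _ = ∫ x, M.stepVar s ∂(M.lawAt s) := by
        refine integral_congr_ae ?_
        filter_upwards [M.ae_lawAt_S_zero s] with x hx
        simp only [hx]
    _ = M.stepVar s := by simp

lemma tsum_state_measure_mul_stepVar (hR : M.BoundedReward) (s s' : X) (t t' j : ℕ) :
    ∑' s'' : M.State, M.lawInit {x | S t x = s ∧ S t' x = s' ∧ S j x = s''} *
        ENNReal.ofReal (M.stepVar s'') =
      ENNReal.ofReal
        (∫ x, visitAt s t x * visitAt s' t' x * M.stepVar (S j x) ∂M.lawInit) := by
  have hb : IsBoundedFunctional fun x : Traj X => visitAt s t x * visitAt s' t' x * M.stepVar (S j x) :=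
    ((isBoundedFunctional_visitAt s t).mul (isBoundedFunctional_visitAt s' t')).mul
      (.comp_S M.stepVar j)
  have hset : ∀ s'' : M.State, MeasurableSet {x : Traj X | S t x = s ∧ S t' x = s' ∧ S j x = s''} :=
    fun s'' => ((measurable_S t) (MeasurableSet.of_discrete (s := {s}))).inter
      (((measurable_S t') (MeasurableSet.of_discrete (s := {s'}))).inter
        ((measurable_S j) (MeasurableSet.of_discrete (s := {s''.1}))))
  rw [lawInit, ofReal_integral_eq_lintegral_ofReal (hb.integrable hR _) (ae_of_all _ fun x =>
    mul_nonneg (mul_nonneg (visitAt_nonneg _ _ _) (visitAt_nonneg _ _ _)) (M.stepVar_nonneg _))]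
  have hpt : ∀ x : Traj X,
      ENNReal.ofReal (visitAt s t x * visitAt s' t' x * M.stepVar (S j x)) =
      ∑' s'' : M.State, Set.indicator {x : Traj X | S t x = s ∧ S t' x = s' ∧ S j x = s''}
        (fun _ => ENNReal.ofReal (M.stepVar s'')) x := by
    intro x
    by_cases hj : S j x = M.term
    · rw [hj, M.stepVar_term, mul_zero, ENNReal.ofReal_zero, eq_comm, ENNReal.tsum_eq_zero]
      intro s''
      refine Set.indicator_of_notMem (fun hx => s''.2 ?_) _
      exact hx.2.2.symm.trans hj
    · rw [tsum_eq_single (⟨S j x, hj⟩ : M.State)]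
      · by_cases h1 : S t x = s <;> by_cases h2 : S t' x = s' <;> simp [visitAt, h1, h2]
      · intro s'' hs''
        refine Set.indicator_of_notMem (fun hx => hs'' ?_) _
        exact Subtype.ext hx.2.2.symm
  simp_rw [hpt]
  have : Countable M.State := inferInstance
  rw [lintegral_tsum fun s'' => (measurable_const.indicator (hset s'')).aemeasurable]
  refine tsum_congr fun s'' => ?_
  rw [lintegral_indicator_const (hset s''), mul_comm]

/-- With `j` summed last, the sums over `t, t' ≤ j` recombine into the product of the two visit
counts up to `j`; what remains is the series of martingale second moments. It also shows that the
defining sum is finite. -/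
lemma visitVarSum_eq (hEff : M.EffHorizon h) (hR : M.BoundedReward) {s s' : X}
    (hs : s ≠ M.term) (hs' : s' ≠ M.term) :
    M.visitVarSum s s' = ENNReal.ofReal (∫ x, M.residual s x * M.residual s' x ∂M.lawInit) := by
  have hb : ∀ t t' j, IsBoundedFunctional fun x : Traj X =>
      visitAt s t x * visitAt s' t' x * M.stepVar (S j x) := fun t t' j =>
    ((isBoundedFunctional_visitAt s t).mul (isBoundedFunctional_visitAt s' t')).mul
      (.comp_S M.stepVar j)
  have h0 : ∀ t t' j x, 0 ≤ visitAt s t x * visitAt s' t' x * M.stepVar (S j x) := fun t t' j x =>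
    mul_nonneg (mul_nonneg (visitAt_nonneg _ _ _) (visitAt_nonneg _ _ _)) (M.stepVar_nonneg _)
  have hj : ∀ j, ∑ t ∈ Finset.range (j + 1), ∑ t' ∈ Finset.range (j + 1), ENNReal.ofReal
      (∫ x, visitAt s t x * visitAt s' t' x * M.stepVar (S j x) ∂M.lawInit) =
      ENNReal.ofReal
        (∫ x, visitsUpTo s j x * visitsUpTo s' j x * M.stepVar (S j x) ∂M.lawInit) := by
    intro j
    simp_rw [visitsUpTo, Finset.sum_mul_sum, Finset.sum_mul]
    rw [lawInit, integral_finsetSum _ fun t _ => (IsBoundedFunctional.sum _ fun t' =>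
      hb t t' j).integrable hR _]
    rw [ENNReal.ofReal_sum_of_nonneg fun t _ => integral_nonneg fun x =>
      Finset.sum_nonneg fun t' _ => h0 t t' j x]
    refine Finset.sum_congr rfl fun t _ => ?_
    rw [integral_finsetSum _ fun t' _ => (hb t t' j).integrable hR _]
    rw [ENNReal.ofReal_sum_of_nonneg fun t' _ => integral_nonneg fun x => h0 t t' j x]
  have hc : ∀ j, 0 ≤ ∫ x, visitsUpTo s j x * visitsUpTo s' j x * M.stepVar (S j x) ∂M.lawInit :=
    fun j => integral_nonneg fun x =>
      mul_nonneg (mul_nonneg (visitsUpTo_nonneg _ _ _) (visitsUpTo_nonneg _ _ _))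
        (M.stepVar_nonneg _)
  have hsum := (hasSum_iff_tendsto_nat_of_nonneg hc _).2
    (tendsto_integral_residual_mul hEff hR M.init hs hs')
  unfold visitVarSum
  simp_rw [oneStepVar_eq hEff hR, tsum_state_measure_mul_stepVar hR]
  rw [ENNReal.tsum_tsum_tsum_max_le (fun t t' j => ENNReal.ofReal
    (∫ x, visitAt s t x * visitAt s' t' x * M.stepVar (S j x) ∂M.lawInit))]
  simp_rw [hj]
  rw [← ENNReal.ofReal_tsum_of_nonneg hc hsum.summable, hsum.tsum_eq]
  rfl

lemma integrable_visits (hEff : M.EffHorizon h) (hR : M.BoundedReward) (ρ : Measure X)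
    [IsProbabilityMeasure ρ] {s : X} (hs : s ≠ M.term) : Integrable (visits s) (M.law ρ) := by
  have hb := hEff.integrable_hitTime_pow ρ le_rfl
  simp only [pow_one] at hb
  refine hb.mono' (aestronglyMeasurable_of_tendsto_ae atTop
    (f := fun J x => ∑ t ∈ Finset.range J, visitAt s t x) (fun J =>
      (IsBoundedFunctional.sum _ fun t => isBoundedFunctional_visitAt s t).1.aestronglyMeasurable)
      ?_) ?_
  · filter_upwards [ae_isRegular hEff hR ρ] with x hx using (hx.hasSum_visitAt hs).tendsto_sum_nat
  · filter_upwards [ae_isRegular hEff hR ρ] with x hx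
    rw [Real.norm_of_nonneg]
    · exact hx.visits_le hs
    · exact tsum_nonneg fun t => visitAt_nonneg s t x

lemma occ_eq (hEff : M.EffHorizon h) (hR : M.BoundedReward) {s : X} (hs : s ≠ M.term) :
    M.occ s = ENNReal.ofReal (∫ x, visits s x ∂M.lawInit) := by
  have hset : ∀ t, MeasurableSet {x : Traj X | S t x = s} := fun t =>
    (measurable_S t) (MeasurableSet.of_discrete (s := {s}))
  rw [lawInit, ofReal_integral_eq_lintegral_ofReal (integrable_visits hEff hR M.init hs)
    (ae_of_all _ fun x => tsum_nonneg fun t => visitAt_nonneg s t x)]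
  have h1 : ∀ᵐ x ∂M.law M.init, ENNReal.ofReal (visits s x) =
      ∑' t, Set.indicator {x : Traj X | S t x = s} (fun _ => (1 : ℝ≥0∞)) x := by
    filter_upwards [ae_isRegular hEff hR M.init] with x hx
    rw [← (hx.hasSum_visitAt hs).tsum_eq, ENNReal.ofReal_tsum_of_nonneg
      (fun t => visitAt_nonneg s t x) (hx.hasSum_visitAt hs).summable]
    refine tsum_congr fun t => ?_
    by_cases h : S t x = s <;> simp [visitAt, h]
  rw [lintegral_congr_ae h1,
    lintegral_tsum fun t => (measurable_const.indicator (hset t)).aemeasurable]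
  refine tsum_congr fun t => ?_
  rw [lintegral_indicator_const (hset t), one_mul, lawInit]

lemma aestronglyMeasurable_rolloutSum (hEff : M.EffHorizon h) (hR : M.BoundedReward)
    (ρ : Measure X) [IsProbabilityMeasure ρ] {s : X} (hs : s ≠ M.term) :
    AEStronglyMeasurable (rolloutSum s) (M.law ρ) := by
  have := (aestronglyMeasurable_residual hEff hR ρ hs).add
    ((integrable_visits hEff hR ρ hs).aestronglyMeasurable.const_mul (M.value s))
  refine this.congr (ae_of_all _ fun x => ?_)
  simp [residual]

lemma mcCov_apply (hEff : M.EffHorizon h) (hR : M.BoundedReward) (s s' : M.Reachable) :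
    M.mcCov s s' = ∫ x, (-(M.occ s).toReal⁻¹ * M.residual s x) *
      (-(M.occ s').toReal⁻¹ * M.residual s' x) ∂M.lawInit := by
  have e : ∀ x, (-(M.occ s).toReal⁻¹ * M.residual s x) *
      (-(M.occ s').toReal⁻¹ * M.residual s' x) =
      (1 / ((M.occ s).toReal * (M.occ s').toReal)) * (M.residual s x * M.residual s' x) :=
    fun x => by rw [one_div, mul_inv]; ring
  -- For `s ≠ s'` the integrand has no sign; nonnegativity comes from the limit formula, whose terms
  -- are nonnegative. Without it `ENNReal.ofReal` would truncate.
  have h0 : 0 ≤ ∫ x, M.residual s x * M.residual s' x ∂M.lawInit := by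
    refine ge_of_tendsto' (tendsto_integral_residual_mul hEff hR M.init s.2.1 s'.2.1) fun J => ?_
    exact Finset.sum_nonneg fun j _ => integral_nonneg fun x =>
      mul_nonneg (mul_nonneg (visitsUpTo_nonneg _ _ _) (visitsUpTo_nonneg _ _ _))
        (M.stepVar_nonneg _)
  simp_rw [e]
  rw [integral_const_mul, mcCov, Matrix.of_apply, visitVarSum_eq hEff hR s.2.1 s'.2.1,
    ENNReal.toReal_ofReal h0]

end Covariance
end MRP

/-! ### The multivariate central limit theorem -/

section MultivariateCLT

open scoped RealInnerProductSpace

variable {Ω : Type*} [MeasurableSpace Ω] {P : Measure Ω}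
  {ι : Type*} [Fintype ι]

/-- The matrix of second moments of square integrable random variables is positive semidefinite. -/
lemma Matrix.posSemidef_of_eq_integral_mul {S : Matrix ι ι ℝ} {f : ι → Ω → ℝ}
    (hf : ∀ i, MemLp (f i) 2 P) (hS : ∀ i j, S i j = ∫ ω, f i ω * f j ω ∂P) : S.PosSemidef := by
  refine Matrix.PosSemidef.of_dotProduct_mulVec_nonneg ?_ fun v => ?_
  · ext i j
    simp [hS, mul_comm]
  · have hint : ∀ i j, Integrable (fun ω => v i * f i ω * (v j * f j ω)) P := fun i j =>
      ((hf i).const_mul (v i)).integrable_mul ((hf j).const_mul (v j))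
    have : star v ⬝ᵥ S.mulVec v = ∫ ω, (∑ i, v i * f i ω) ^ 2 ∂P := by
      simp_rw [pow_two, Finset.sum_mul_sum]
      rw [integral_finsetSum _ fun i _ => integrable_finsetSum _ fun j _ => hint i j]
      simp only [dotProduct, Matrix.mulVec, Pi.star_apply, star_trivial, Finset.mul_sum]
      refine Finset.sum_congr rfl fun i _ => ?_
      rw [integral_finsetSum _ fun j _ => hint i j]
      refine Finset.sum_congr rfl fun j _ => ?_
      rw [hS, ← integral_mul_const, ← integral_const_mul]
      refine integral_congr_ae (ae_of_all _ fun ω => ?_)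
      simp only
      ring
    rw [this]
    exact integral_nonneg fun ω => sq_nonneg _

variable [IsProbabilityMeasure P] [DecidableEq ι]

/-- The **central limit theorem** in `ℝ^ι`, for centred random vectors. -/
theorem ProbabilityTheory.tendstoInDistribution_multivariateGaussian
    {Z : ℕ → Ω → EuclideanSpace ℝ ι} {S : Matrix ι ι ℝ} (hS : S.PosSemidef)
    (hindep : iIndepFun Z P) (hident : ∀ i, IdentDistrib (Z i) (Z 0) P P)
    (hL2 : ∀ i, MemLp (fun ω => Z 0 ω i) 2 P) (hmean : ∀ i, ∫ ω, Z 0 ω i ∂P = 0)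
    (hcov : ∀ i j, S i j = ∫ ω, Z 0 ω i * Z 0 ω j ∂P) :
    TendstoInDistribution (fun (n : ℕ) ω => (√(n : ℝ))⁻¹ • ∑ k ∈ Finset.range n, Z k ω) atTop id
      (fun _ => P) (multivariateGaussian 0 S) where
  forall_aemeasurable n :=
    (Finset.aemeasurable_fun_sum _ fun k _ => (hident k).aemeasurable_fst).fun_const_smul _
  tendsto := by
    refine ProbabilityMeasure.tendsto_iff_tendsto_charFun.2 fun v => ?_
    have hZ : ∀ k, AEMeasurable (Z k) P := fun k => (hident k).aemeasurable_fst
    have hinner : ∀ z : EuclideanSpace ℝ ι, ⟪z, v⟫ = ∑ i, v i * z i := fun z => by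
      simp [PiLp.inner_apply]
    -- Cramér–Wold: the projections on `v` are real, i.i.d. and centred, with variance the quadratic
    -- form of `S` at `v`.
    let Y : ℕ → Ω → ℝ := fun k ω => ⟪Z k ω, v⟫
    have hYm : Measurable fun z : EuclideanSpace ℝ ι => ⟪z, v⟫ := by fun_prop
    have hY0 : Y 0 = fun ω => ∑ i, v i * Z 0 ω i := funext fun ω => hinner _
    have hYL2 : MemLp (Y 0) 2 P := by
      rw [hY0]
      exact memLp_finsetSum _ fun i _ => (hL2 i).const_mul (v i)
    have hYmean : ∫ ω, Y 0 ω ∂P = 0 := by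
      rw [hY0, integral_finsetSum _ fun i _ => ((hL2 i).integrable one_le_two).const_mul (v i)]
      simp [integral_const_mul, hmean]
    have hvar : Var[Y 0; P] = v.ofLp ⬝ᵥ S.mulVec v.ofLp := by
      have hint : ∀ i j, Integrable (fun ω => v i * Z 0 ω i * (v j * Z 0 ω j)) P := fun i j =>
        ((hL2 i).const_mul (v i)).integrable_mul ((hL2 j).const_mul (v j))
      rw [variance_of_integral_eq_zero hYL2.1.aemeasurable hYmean]
      simp only [hY0, pow_two, Finset.sum_mul_sum]
      rw [integral_finsetSum _ fun i _ => integrable_finsetSum _ fun j _ => hint i j]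
      simp only [dotProduct, Matrix.mulVec, Finset.mul_sum]
      refine Finset.sum_congr rfl fun i _ => ?_
      rw [integral_finsetSum _ fun j _ => hint i j]
      refine Finset.sum_congr rfl fun j _ => ?_
      rw [hcov, ← integral_mul_const, ← integral_const_mul]
      refine integral_congr_ae (ae_of_all _ fun ω => ?_)
      simp only
      ring
    have hclt := tendstoInDistribution_inv_sqrt_mul_sum_sub (X := Y) (P := P)
      (Y := id) (P' := gaussianReal 0 Var[Y 0; P].toNNReal) (HasLaw.id)
      hYL2 (hindep.comp (fun _ z => ⟪z, v⟫) fun _ => hYm) (fun i => (hident i).comp hYm)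
    -- The characteristic function of a random vector at `v` is that of its projection on `v` at
    -- `1`.
    have h1 := ProbabilityMeasure.tendsto_iff_tendsto_charFun.1 hclt.tendsto 1
    simp only [ProbabilityMeasure.coe_mk, Measure.map_id, charFun_gaussianReal] at h1 ⊢
    rw [charFun_multivariateGaussian hS]
    convert h1 using 2
    · rename_i n
      have hm := (Finset.aemeasurable_fun_sum (Finset.range n) fun k _ => hZ k).fun_const_smul
        (√(n : ℝ))⁻¹
      have hm' : AEMeasurable (fun ω => (√(n : ℝ))⁻¹ *
          (∑ k ∈ Finset.range n, Y k ω - n * ∫ ω, Y 0 ω ∂P)) P := hclt.forall_aemeasurable n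
      rw [charFun_apply, charFun_apply, integral_map hm (by fun_prop),
        integral_map hm' (by fun_prop)]
      refine integral_congr_ae (ae_of_all _ fun ω => ?_)
      simp only [hYmean, mul_zero, sub_zero, real_inner_smul_left, sum_inner, Y]
      simp
    · rw [Real.coe_toNNReal _ (variance_nonneg _ _), hvar]
      simp

end MultivariateCLT

/-! ### Asymptotic normality of the Monte Carlo estimator -/

namespace MRP

variable {X : Type*} [MeasurableSpace X] {M : MRP X}

/-- Away from the event that some reachable state has not been visited, the error of the Monte Carlo
estimator is the average of the influence functions times `ν(s)` over the mean number of visits. -/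
lemma sqrt_mul_value_sub_mcEstimate {n : ℕ} (hn : n ≠ 0) {x : ℕ → Traj X} {s : X} {c : ℝ}
    (hc : c ≠ 0) (hN : ∑ i ∈ Finset.range n, visits s (x i) ≠ 0) :
    √(n : ℝ) * (M.value s - mcEstimate n x s) =
      ((√(n : ℝ))⁻¹ * ∑ i ∈ Finset.range n, -c⁻¹ * M.residual s (x i)) *
        (c * ((∑ i ∈ Finset.range n, visits s (x i)) / n)⁻¹) := by
  have hn' : (0 : ℝ) < n := by positivity
  have hsq : √(n : ℝ) * √(n : ℝ) = n := Real.mul_self_sqrt hn'.le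
  have hs0 : √(n : ℝ) ≠ 0 := (Real.sqrt_pos.2 hn').ne'
  simp only [mcEstimate, residual]
  rw [← Finset.mul_sum, Finset.sum_sub_distrib, ← Finset.mul_sum]
  field_simp
  rw [Real.sq_sqrt hn'.le]
  ring

variable [DiscreteMeasurableSpace X] [Finite X] {h : ℝ}
  {Ω : Type*} [MeasurableSpace Ω] {P : Measure Ω}
  {τ : ℕ → Ω → Traj X}

lemma occ_toReal (hEff : M.EffHorizon h) (hR : M.BoundedReward) (s : M.Reachable) :
    (M.occ s).toReal = ∫ x, visits s.1 x ∂M.lawInit := by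
  rw [occ_eq hEff hR s.2.1, ENNReal.toReal_ofReal]
  exact integral_nonneg fun x => tsum_nonneg fun t => visitAt_nonneg s.1 t x

lemma occ_toReal_pos (hEff : M.EffHorizon h) (hR : M.BoundedReward) (s : M.Reachable) :
    0 < (M.occ s).toReal :=
  ENNReal.toReal_pos s.2.2.ne' (by rw [occ_eq hEff hR s.2.1]; exact ENNReal.ofReal_ne_top)

variable (M) in
/-- The influence function `-ν(s)⁻¹ ∑_t 1{S_t = s} (∑_{ℓ ≥ t} R_ℓ - V⋆(s))` of the Monte Carlo
estimator. -/
noncomputable def influence (x : Traj X) : EuclideanSpace ℝ M.Reachable :=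
  WithLp.toLp 2 fun s => -(M.occ s).toReal⁻¹ * M.residual s x

lemma aemeasurable_influence (hEff : M.EffHorizon h) (hR : M.BoundedReward) :
    AEMeasurable M.influence M.lawInit := by
  refine (PiLp.continuous_toLp 2 _).measurable.comp_aemeasurable (aemeasurable_pi_iff.2 fun s => ?_)
  exact (aestronglyMeasurable_residual hEff hR M.init s.2.1).aemeasurable.const_mul _

lemma posSemidef_mcCov (hEff : M.EffHorizon h) (hR : M.BoundedReward) : M.mcCov.PosSemidef :=
  Matrix.posSemidef_of_eq_integral_mul (P := M.lawInit)
    (f := fun (s : M.Reachable) x => -(M.occ s).toReal⁻¹ * M.residual s x)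
    (fun s => (memLp_residual hEff hR M.init s.2.1).const_mul _) (mcCov_apply hEff hR)

lemma tendstoInDistribution_influence [IsProbabilityMeasure P] (hEff : M.EffHorizon h)
    (hR : M.BoundedReward)
    (hindep : iIndepFun τ P) (hlaw : ∀ i, HasLaw (τ i) M.lawInit P) :
    TendstoInDistribution
      (fun (n : ℕ) ω => (√(n : ℝ))⁻¹ • ∑ k ∈ Finset.range n, M.influence (τ k ω)) atTop id
      (fun _ => P) (multivariateGaussian 0 M.mcCov) := by
  have hinf := aemeasurable_influence hEff hR
  have hcomp : ∀ f : Traj X → ℝ, AEStronglyMeasurable f M.lawInit →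
      ∫ ω, f (τ 0 ω) ∂P = ∫ x, f x ∂M.lawInit := fun f hf => by
    rw [← (hlaw 0).map_eq] at hf ⊢
    rw [integral_map (hlaw 0).aemeasurable hf]
  have hL2 : ∀ s : M.Reachable, MemLp (fun x => -(M.occ s).toReal⁻¹ * M.residual s x) 2 M.lawInit :=
    fun s => (memLp_residual hEff hR M.init s.2.1).const_mul _
  refine tendstoInDistribution_multivariateGaussian (Z := fun k ω => M.influence (τ k ω))
    (posSemidef_mcCov hEff hR) ?_ ?_ ?_ ?_ ?_
  · refine hindep.comp₀ (fun _ => M.influence) (fun i => (hlaw i).aemeasurable) fun i => ?_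
    rw [(hlaw i).map_eq]
    exact hinf
  · intro i
    refine ((hlaw i).identDistrib (hlaw 0)).comp_of_aemeasurable (u := M.influence) ?_
    rw [(hlaw i).map_eq]
    exact hinf
  · intro s
    have := hL2 s
    rw [← (hlaw 0).map_eq] at this
    exact this.comp_of_map (hlaw 0).aemeasurable
  · intro s
    refine (hcomp (fun x => M.influence x s) (hL2 s).1).trans ?_
    simp only [influence, integral_const_mul]
    rw [show ∫ x, M.residual s x ∂M.lawInit = 0 from integral_residual hEff hR M.init s.2.1,
      mul_zero]
  · intro s s'
    rw [mcCov_apply hEff hR]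
    exact (hcomp (fun x => M.influence x s * M.influence x s') ((hL2 s).1.mul (hL2 s').1)).symm

lemma ae_tendsto_mean_visits (hEff : M.EffHorizon h) (hR : M.BoundedReward)
    (hindep : iIndepFun τ P) (hlaw : ∀ i, HasLaw (τ i) M.lawInit P) :
    ∀ᵐ ω ∂P, ∀ s : M.Reachable, Tendsto
      (fun n : ℕ => (∑ i ∈ Finset.range n, visits s.1 (τ i ω)) / n) atTop
      (𝓝 (M.occ s).toReal) := by
  rw [ae_all_iff]
  intro s
  have hint : Integrable (visits s.1) M.lawInit := integrable_visits hEff hR M.init s.2.1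
  have hint' : ∀ i, AEMeasurable (visits s.1) (P.map (τ i)) := fun i => by
    rw [(hlaw i).map_eq]; exact hint.aemeasurable
  have hmean : ∫ ω, visits s.1 (τ 0 ω) ∂P = (M.occ s).toReal := by
    rw [occ_toReal hEff hR, ← (hlaw 0).map_eq,
      integral_map (hlaw 0).aemeasurable (hint' 0).aestronglyMeasurable]
  rw [← hmean]
  refine strong_law_ae_real (fun i ω => visits s.1 (τ i ω)) ?_ ?_ ?_
  · have := hint
    rw [← (hlaw 0).map_eq] at this
    exact this.comp_aemeasurable (hlaw 0).aemeasurable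
  · intro i j hij
    exact (hindep.comp₀ (fun _ => visits s.1) (fun i => (hlaw i).aemeasurable) hint').indepFun hij
  · intro i
    exact ((hlaw i).identDistrib (hlaw 0)).comp_of_aemeasurable (hint' i)

/-- Slutsky's theorem for the coordinatewise product of the normalised influence sum and the visit
ratio `B`. The ratio tends to the all-ones vector, so the Gaussian limit is unchanged. -/
theorem tendstoInDistribution_mcEstimate [IsProbabilityMeasure P] (hEff : M.EffHorizon h)
    (hR : M.BoundedReward)
    (hindep : iIndepFun τ P) (hlaw : ∀ i, HasLaw (τ i) M.lawInit P) :
    TendstoInDistribution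
      (fun (n : ℕ) (ω : Ω) => (WithLp.toLp 2 fun s : M.Reachable =>
        √(n : ℝ) * (M.value s - mcEstimate n (fun i => τ i ω) s) :
          EuclideanSpace ℝ M.Reachable))
      atTop id (fun _ => P) (multivariateGaussian 0 M.mcCov) := by
  have hvis : ∀ (s : M.Reachable) n, AEMeasurable
      (fun ω => ∑ i ∈ Finset.range n, visits s.1 (τ i ω)) P := fun s n => by
    refine Finset.aemeasurable_fun_sum _ fun i _ => ?_
    refine AEMeasurable.comp_aemeasurable (g := visits s.1) ?_ (hlaw i).aemeasurable
    rw [(hlaw i).map_eq]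
    exact (integrable_visits hEff hR M.init s.2.1).aemeasurable
  have hroll : ∀ (s : M.Reachable) n, AEMeasurable
      (fun ω => ∑ i ∈ Finset.range n, rolloutSum s.1 (τ i ω)) P := fun s n => by
    refine Finset.aemeasurable_fun_sum _ fun i _ => ?_
    refine AEMeasurable.comp_aemeasurable (g := rolloutSum s.1) ?_ (hlaw i).aemeasurable
    rw [(hlaw i).map_eq]
    exact (aestronglyMeasurable_rolloutSum hEff hR M.init s.2.1).aemeasurable
  have htoLp : Measurable (WithLp.toLp 2 : (M.Reachable → ℝ) → EuclideanSpace ℝ M.Reachable) :=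
    (PiLp.continuous_toLp 2 _).measurable
  let B : ℕ → Ω → EuclideanSpace ℝ M.Reachable := fun n ω => WithLp.toLp 2 fun s =>
    (M.occ s).toReal * ((∑ i ∈ Finset.range n, visits s.1 (τ i ω)) / n)⁻¹
  have hB : ∀ n, AEMeasurable (B n) P := fun n =>
    htoLp.comp_aemeasurable (aemeasurable_pi_iff.2 fun s =>
      (((hvis s n).div_const _).inv.const_mul _))
  have hlln := ae_tendsto_mean_visits hEff hR hindep hlaw
  have hBlim : TendstoInMeasure P B atTop (fun _ => WithLp.toLp 2 fun _ => (1 : ℝ)) := by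
    refine tendstoInMeasure_of_tendsto_ae (fun n => (hB n).aestronglyMeasurable) ?_
    filter_upwards [hlln] with ω hω
    refine ((PiLp.continuous_toLp 2 _).tendsto _).comp (tendsto_pi_nhds.2 fun s => ?_)
    have hpos := (occ_toReal_pos hEff hR s).ne'
    have := ((hω s).inv₀ hpos).const_mul (M.occ s).toReal
    rwa [mul_inv_cancel₀ hpos] at this
  let g : EuclideanSpace ℝ M.Reachable × EuclideanSpace ℝ M.Reachable →
    EuclideanSpace ℝ M.Reachable := fun p => WithLp.toLp 2 fun s => p.1 s * p.2 s
  have hg : Continuous g := by fun_prop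
  have hX := (tendstoInDistribution_influence hEff hR hindep
    hlaw).continuous_comp_prodMk_of_tendstoInMeasure_const hg hBlim hB
  have hid : (fun z : EuclideanSpace ℝ M.Reachable => g (id z, WithLp.toLp 2 fun _ => (1 : ℝ))) =
      id := by
    funext z
    ext s
    simp [g]
  rw [hid] at hX
  have hT : ∀ n : ℕ, AEMeasurable (fun ω => (WithLp.toLp 2 fun s : M.Reachable =>
      √(n : ℝ) * (M.value s - mcEstimate n (fun i => τ i ω) s) :
        EuclideanSpace ℝ M.Reachable)) P := fun n =>
    htoLp.comp_aemeasurable (aemeasurable_pi_iff.2 fun s =>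
      (((hroll s n).div (hvis s n)).const_sub _).const_mul _)
  -- The factorisation of the error requires a nonzero visit count. Almost surely it holds for all
  -- large `n`, simultaneously at the finitely many reachable states, so the difference is
  -- eventually zero.
  refine tendstoInDistribution_of_tendstoInMeasure_sub _ _ hX ?_ hT
  refine tendstoInMeasure_of_tendsto_ae
    (fun n => ((hT n).sub (hX.forall_aemeasurable n)).aestronglyMeasurable) ?_
  filter_upwards [hlln] with ω hω
  refine tendsto_const_nhds.congr' ?_
  have hev : ∀ᶠ n : ℕ in atTop, ∀ s : M.Reachable,
      0 < (∑ i ∈ Finset.range n, visits s.1 (τ i ω)) / n :=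
    eventually_all.2 fun s => (hω s).eventually_const_lt (occ_toReal_pos hEff hR s)
  filter_upwards [hev, eventually_ne_atTop 0] with n hn hn0
  ext s
  have hN : ∑ i ∈ Finset.range n, visits s.1 (τ i ω) ≠ 0 := fun h0 => by
    simpa [h0] using hn s
  have := sqrt_mul_value_sub_mcEstimate (M := M) hn0 (x := fun i => τ i ω) (s := s.1)
    (occ_toReal_pos hEff hR s).ne' hN
  simp [g, B, influence, this]

end MRP

theorem proposition1 {X : Type*} [Finite X] [MeasurableSpace X] [MeasurableSingletonClass X]
    (M : MRP X) (h : ℝ) (hEff : M.EffHorizon h) (hR : M.BoundedReward)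
    {Ω : Type*} [MeasurableSpace Ω] (P : Measure Ω) [IsProbabilityMeasure P]
    (τ : ℕ → Ω → MRP.Traj X) (hτ_indep : iIndepFun τ P)
    (hτ_law : ∀ i, HasLaw (τ i) M.lawInit P) :
    -- the quantities in the claim are well defined
    (∀ s : X, (∀ᵐ x ∂(M.lawAt s), Summable fun t => MRP.R t x) ∧
      Integrable MRP.total (M.lawAt s) ∧ M.oneStepVar s ≠ ∞) ∧
    (∀ s : M.State, M.occ s ≠ ∞) ∧
    (∀ s s' : M.State, M.visitVarSum s s' ≠ ∞) ∧
    M.mcCov.PosSemidef ∧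
    -- convergence in distribution of `√n (V⋆ - V̂_MC)`
    TendstoInDistribution
      (fun (n : ℕ) (ω : Ω) => (WithLp.toLp 2 fun s : M.Reachable =>
        √(n : ℝ) * (M.value s - MRP.mcEstimate n (fun i => τ i ω) s) :
          EuclideanSpace ℝ M.Reachable))
      atTop id (fun _ => P) (multivariateGaussian 0 M.mcCov) := by
  refine ⟨fun s => ⟨?_, MRP.integrable_total hEff hR _, ?_⟩, fun s => ?_, fun s s' => ?_,
    MRP.posSemidef_mcCov hEff hR, MRP.tendstoInDistribution_mcEstimate hEff hR hτ_indep hτ_law⟩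
  · filter_upwards [MRP.ae_isRegular hEff hR (Measure.dirac s)] with x hx using hx.summable
  · rw [MRP.oneStepVar_eq hEff hR]
    exact ENNReal.ofReal_ne_top
  · rw [MRP.occ_eq hEff hR s.2]
    exact ENNReal.ofReal_ne_top
  · rw [MRP.visitVarSum_eq hEff hR s.2 s'.2]
    exact ENNReal.ofReal_ne_top
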